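/- Let $K$ be a number field, let $X$ be a projective variety over $K$ (that is, an integral projective scheme over $K$), and let $f \colon X \to X$ be an étale morphism over $K$. Let $Y \subset X$ be a closed subscheme which is $f$-invariant, that is, such that $f|_Y$ factors through $Y \subset X$. Let $d \geq 1$ be an integer. Then there exists a non-negative integer $s_0$ such that $$\bigl(f^{-s-1}(Y) \smallsetminus f^{-s}(Y)\bigr)(L) = \emptyset$$ for all field extensions $K \subset L$ with $[L:K] \leq d$ and all $s \geq s_0$. Here $f^{-n}(Y)$ denotes the scheme-theoretic preimage of $Y$ under the $n$-th iterate $f^n$ of $f$ (with $f^0 = \mathrm{id}_X$), $f^{-s-1}(Y) \smallsetminus f^{-s}(Y)$ is regarded as an open subscheme of $f^{-s-1}(Y)$, and $(\,\cdot\,)(L)$ denotes the set of $L$-valued points over $K$. -/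

import Mathlib

open AlgebraicGeometry CategoryTheory CategoryTheory.Limits

universe u

noncomputable section

namespace PreimagesQuestion

attribute [local instance] MvPolynomial.gradedAlgebra

/-- Projective `n`-space over a field `K`: the Proj of `K[x₀, …, xₙ]`, graded by degree. -/
def projSpace (K : Type u) [Field K] (n : ℕ) : Scheme.{u} :=
  Proj (MvPolynomial.homogeneousSubmodule (Fin (n + 1)) K)

/-- The structure morphism of projective space: `Proj A ⟶ Spec A₀ ⟶ Spec K`. -/
def projSpaceToSpec (K : Type u) [Field K] (n : ℕ) :
    projSpace K n ⟶ Spec (CommRingCat.of K) :=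
  Proj.toSpecZero (MvPolynomial.homogeneousSubmodule (Fin (n + 1)) K) ≫
    Spec.map (CommRingCat.ofHom
      (algebraMap K (MvPolynomial.homogeneousSubmodule (Fin (n + 1)) K 0)))

/-- A `K`-scheme `p : X ⟶ Spec K` is projective if it is isomorphic, over `K`, to a closed
subscheme of some projective space. -/
def IsProjective {K : Type u} [Field K] {X : Scheme.{u}} (p : X ⟶ Spec (CommRingCat.of K)) :
    Prop :=
  ∃ (n : ℕ) (j : X ⟶ projSpace K n), IsClosedImmersion j ∧ j ≫ projSpaceToSpec K n = p

/-- A projective variety over `K`: an integral projective `K`-scheme. -/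
structure IsProjectiveVariety {K : Type u} [Field K] {X : Scheme.{u}}
    (p : X ⟶ Spec (CommRingCat.of K)) : Prop where
  isIntegral : IsIntegral X
  isProjective : IsProjective p

/-- The `n`-th iterate of a self-morphism. -/
def iter {X : Scheme.{u}} (f : X ⟶ X) : ℕ → (X ⟶ X)
  | 0 => 𝟙 X
  | n + 1 => iter f n ≫ f

/-- A closed subscheme `i : Y ⟶ X` is invariant under `f` if `f` restricted to `Y` factors
through `Y`. -/
def IsInvariant {X Y : Scheme.{u}} (f : X ⟶ X) (i : Y ⟶ X) : Prop :=
  ∃ g : Y ⟶ Y, g ≫ i = i ≫ f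

/-- The scheme-theoretic preimage `f^{-n}(Y)`, the fibre product of `f^n` with the inclusion
`i : Y ⟶ X`. -/
abbrev preimage {X Y : Scheme.{u}} (f : X ⟶ X) (i : Y ⟶ X) (n : ℕ) : Scheme.{u} :=
  pullback (iter f n) i

/-- The inclusion of `f^{-n}(Y)` in `X`. -/
abbrev preimageι {X Y : Scheme.{u}} (f : X ⟶ X) (i : Y ⟶ X) (n : ℕ) : preimage f i n ⟶ X :=
  pullback.fst (iter f n) i

/-- The inclusion of `f^{-n}(Y)` in `X` is a closed immersion. -/
instance preimageι_isClosedImmersion {X Y : Scheme.{u}} (f : X ⟶ X) (i : Y ⟶ X)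
    [IsClosedImmersion i] (n : ℕ) : IsClosedImmersion (preimageι f i n) :=
  IsClosedImmersion.isStableUnderBaseChange.of_isPullback
    (IsPullback.of_hasPullback (iter f n) i).flip inferInstance

/-- The complement of `f^{-n}(Y)`, as an open subset of `X`. -/
def preimageCompl {X Y : Scheme.{u}} (f : X ⟶ X) (i : Y ⟶ X) [IsClosedImmersion i] (n : ℕ) :
    X.Opens :=
  ⟨(Set.range (preimageι f i n))ᶜ, (preimageι f i n).isClosedEmbedding.isClosed_range.isOpen_compl⟩

/-- `f^{-s-1}(Y) ∖ f^{-s}(Y)`, as an open subscheme of `f^{-s-1}(Y)`. -/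
abbrev preimageDiff {X Y : Scheme.{u}} (f : X ⟶ X) (i : Y ⟶ X) [IsClosedImmersion i] (s : ℕ) :
    Scheme.{u} :=
  ((preimageι f i (s + 1)) ⁻¹ᵁ (preimageCompl f i s)).toScheme

/-- The inclusion of `f^{-s-1}(Y) ∖ f^{-s}(Y)` in `X`. -/
def preimageDiffι {X Y : Scheme.{u}} (f : X ⟶ X) (i : Y ⟶ X) [IsClosedImmersion i] (s : ℕ) :
    preimageDiff f i s ⟶ X :=
  ((preimageι f i (s + 1)) ⁻¹ᵁ (preimageCompl f i s)).ι ≫ preimageι f i (s + 1)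

/-- The set `Z(L)` of `L`-points of a `K`-scheme `z : Z ⟶ Spec K`, for a field extension `L` of
`K`: the morphisms `Spec L ⟶ Z` over `Spec K`. -/
def Points {K : Type u} [Field K] {Z : Scheme.{u}} (z : Z ⟶ Spec (CommRingCat.of K))
    (L : Type u) [Field L] [Algebra K L] : Type u :=
  {x : Spec (CommRingCat.of L) ⟶ Z // x ≫ z = Spec.map (CommRingCat.ofHom (algebraMap K L))}

end PreimagesQuestion

end

/-!
Points of bounded degree are compared modulo powers of a prime of good reduction.

Let `x` be an `L`-point of `X` with `[L : K] ≤ d`, and let `W` be the local ring of `L` at a place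
above a suitable fixed prime number `p`. Since `X` is projective, `x` has coprime homogeneous
coordinates in `W`, so that congruence of points modulo the power `m ^ k` of the maximal ideal `m`
of `W` makes sense. Suppose that, at all places above `p`,

* points that are congruent modulo `m` have images under `f` that are congruent modulo `m`;
* if moreover these images are congruent modulo `m ^ k`, so are the points themselves.

The residue fields of the rings `W` have at most `p ^ (d * [K : ℚ])` elements, so there is a number
`s₀`, independent of `x` and `L`, such that the reductions modulo `m` of `x, f x, f² x, …` are
periodic from the `s₀`-th one on. On the points with periodic reduction, `f` is injective modulo `m ^ k`,
and as there are only finitely many points modulo `m ^ k`, the point `f^s x` is periodic modulo `m ^ k`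
for every `s ≥ s₀`. If `f^(s + 1) x` lies in `Y`, so does its forward orbit, and `f^s x` is
congruent to a point of `Y` modulo every power of `m`. Hence it lies in `Y`. This is
`iterate_mem_of_iterate_succ_mem`.

No integral model of `X` is needed for the two properties of `f`. In terms of finitely many affine
charts they follow from finitely many polynomial identities over `K`, and it suffices that the
coefficients of these identities lie in `W`, which holds for all but finitely many `p`
(`exists_localRing_of_finset`). The second property expresses that `f` is unramified: there is an
element `e` of `C ⊗[K] C` that equals `1` on the diagonal and multiplies each `1 ⊗ c - c ⊗ 1` into
the ideal generated by the functions pulled back along `f` from the ideal of the diagonal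
(`exists_finset_congr_of_unramified`).
-/

namespace PreimagesQuestion

/-! ### Backward orbits under a map with finite congruence quotients -/

/-- The relations `R k` play the role of congruence modulo the `k`-th power of a prime.
The images of `x, f x, f² x, …` modulo the first power are periodic after at most `#(C 1)` steps.
On points with periodic reduction `f` is injective modulo the `k`-th power, by `lift`, so these
points are periodic modulo every power. Hence `f^[s] x` is congruent to a point of the forward
orbit of `f^[s + 1] x`. -/
theorem iterate_mem_of_iterate_succ_mem {E : Type*} (f : E → E) (Y : Set E)
    (hY : ∀ x ∈ Y, f x ∈ Y) (R : ℕ → E → E → Prop)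
    (trans_one : ∀ x y z, R 1 x y → R 1 y z → R 1 x z)
    (map_one : ∀ x y, R 1 x y → R 1 (f x) (f y))
    (lift : ∀ k, 1 ≤ k → ∀ x y, R 1 x y → R k (f x) (f y) → R k x y)
    (C : ℕ → Type*) [∀ k, Finite (C k)] (ρ : ∀ k, E → C k)
    (hρ : ∀ k, 1 ≤ k → ∀ x y, ρ k x = ρ k y → R k x y)
    (closed : ∀ x, (∀ k, 1 ≤ k → ∃ y ∈ Y, R k x y) → x ∈ Y)
    {M : ℕ} (hM : Nat.card (C 1) ≤ M) {s : ℕ} (hs : M ≤ s) (x : E)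
    (hx : f^[s + 1] x ∈ Y) : f^[s] x ∈ Y := by
  have fwd : ∀ n, f^[s + 1 + n] x ∈ Y := by
    intro n
    induction n with
    | zero => exact hx
    | succ n ih =>
      rw [← add_assoc, Function.iterate_succ_apply']
      exact hY _ ih
  obtain ⟨i, T, hi, hT, hper⟩ :
      ∃ i T, i ≤ M ∧ 1 ≤ T ∧ R 1 (f^[i] x) (f^[i + T] x) := by
    have := Fintype.ofFinite (C 1)
    obtain ⟨a, b, hab, h⟩ := Fintype.exists_ne_map_eq_of_card_lt
      (fun j : Fin (M + 1) ↦ ρ 1 (f^[j] x)) (by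
        rw [Fintype.card_fin, ← Nat.card_eq_fintype_card]
        omega)
    rcases lt_or_gt_of_ne hab with h' | h'
    · refine ⟨a, b - a, by omega, by have := Fin.lt_def.mp h'; omega, hρ 1 le_rfl _ _ ?_⟩
      rw [show (a : ℕ) + (b - a) = b by have := Fin.lt_def.mp h'; omega]
      exact h
    · refine ⟨b, a - b, by omega, by have := Fin.lt_def.mp h'; omega, hρ 1 le_rfl _ _ ?_⟩
      rw [show (b : ℕ) + (a - b) = a by have := Fin.lt_def.mp h'; omega]
      exact h.symm
  have step : ∀ n, i ≤ n → R 1 (f^[n] x) (f^[n + T] x) := by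
    intro n hn
    induction n, hn using Nat.le_induction with
    | base => exact hper
    | succ n _ ih =>
      rw [Nat.add_right_comm, Function.iterate_succ_apply', Function.iterate_succ_apply']
      exact map_one _ _ ih
  have steps : ∀ n, s ≤ n → ∀ m, R 1 (f^[n] x) (f^[n + (m + 1) * T] x) := by
    intro n hn m
    induction m with
    | zero => simpa using step n (by omega)
    | succ m ih =>
      rw [show n + (m + 1 + 1) * T = n + (m + 1) * T + T by ring]
      exact trans_one _ _ _ ih (step _ (by omega))
  refine closed _ fun k hk ↦ ?_
  obtain ⟨m, r, h⟩ : ∃ m r, R k (f^[s + m] x) (f^[s + m + (r + 1) * T] x) := by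
    obtain ⟨a, b, hab, h⟩ := Finite.exists_ne_map_eq_of_infinite
      (fun j : ℕ ↦ ρ k (f^[s + j * T] x))
    rcases lt_or_gt_of_ne hab with h' | h'
    · obtain ⟨r, rfl⟩ := Nat.exists_eq_add_of_lt h'
      refine ⟨a * T, r, hρ k hk _ _ ?_⟩
      rw [show s + a * T + (r + 1) * T = s + (a + r + 1) * T by ring]
      exact h
    · obtain ⟨r, rfl⟩ := Nat.exists_eq_add_of_lt h'
      refine ⟨b * T, r, hρ k hk _ _ ?_⟩
      rw [show s + b * T + (r + 1) * T = s + (b + r + 1) * T by ring]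
      exact h.symm
  refine ⟨f^[s + (r + 1) * T] x, ?_, ?_⟩
  · have : 1 ≤ (r + 1) * T := Nat.mul_pos (by omega) hT
    have := fwd ((r + 1) * T - 1)
    rwa [show s + 1 + ((r + 1) * T - 1) = s + (r + 1) * T by omega] at this
  · -- descent from `s + m` to `s`
    induction m with
    | zero => exact h
    | succ m ih =>
      refine ih (lift k hk _ _ (steps _ (by omega) r) ?_)
      rw [← Function.iterate_succ_apply' f, ← Function.iterate_succ_apply' f]
      convert h using 2
      all_goals
        rw [Nat.succ_eq_add_one]
        ring

/-! ### Congruences in the fraction field of a local ring -/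

section Congruence

variable (W L : Type*) [CommRing W] [IsLocalRing W] [Field L] [Algebra W L]

/-- The pairs of elements of `W ⊆ L` that are congruent modulo the `k`-th power of the maximal
ideal of `W`. That they form a ring is what transports congruences between coordinates of points
to congruences between values of functions. -/
def congrSubring (k : ℕ) : Subring (L × L) where
  carrier := {z | ∃ a b : W, a - b ∈ IsLocalRing.maximalIdeal W ^ k ∧
    algebraMap W L a = z.1 ∧ algebraMap W L b = z.2}
  mul_mem' := by
    rintro _ _ ⟨a, b, h, h₁, h₂⟩ ⟨a', b', h', h₁', h₂'⟩
    refine ⟨a * a', b * b', ?_, by simp [h₁, h₁'], by simp [h₂, h₂']⟩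
    rw [show a * a' - b * b' = a * (a' - b') + b' * (a - b) by ring]
    exact add_mem (Ideal.mul_mem_left _ _ h') (Ideal.mul_mem_left _ _ h)
  one_mem' := ⟨1, 1, by simp, by simp, by simp⟩
  add_mem' := by
    rintro _ _ ⟨a, b, h, h₁, h₂⟩ ⟨a', b', h', h₁', h₂'⟩
    refine ⟨a + a', b + b', ?_, by simp [h₁, h₁'], by simp [h₂, h₂']⟩
    rw [show a + a' - (b + b') = (a - b) + (a' - b') by ring]
    exact add_mem h h'
  zero_mem' := ⟨0, 0, by simp, by simp, by simp⟩
  neg_mem' := by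
    rintro _ ⟨a, b, h, h₁, h₂⟩
    refine ⟨-a, -b, ?_, by simp [h₁], by simp [h₂]⟩
    rw [show -a - -b = -(a - b) by ring]
    exact neg_mem h

variable {W L}

theorem diag_mem_congrSubring {k : ℕ} {a : L} (h : a ∈ (algebraMap W L).range) :
    (a, a) ∈ congrSubring W L k := by
  obtain ⟨a, rfl⟩ := h
  exact ⟨a, a, by simp, rfl, rfl⟩

theorem swap_mem_congrSubring {k : ℕ} {a b : L} (h : (a, b) ∈ congrSubring W L k) :
    (b, a) ∈ congrSubring W L k := by
  obtain ⟨a', b', h, h₁, h₂⟩ := h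
  exact ⟨b', a', by rw [← neg_sub]; exact neg_mem h, h₂, h₁⟩

theorem fst_mem_range_of_mem_congrSubring {k : ℕ} {z : L × L} (h : z ∈ congrSubring W L k) :
    z.1 ∈ (algebraMap W L).range := by
  obtain ⟨a, b, -, h₁, -⟩ := h
  exact ⟨a, h₁⟩

theorem snd_mem_range_of_mem_congrSubring {k : ℕ} {z : L × L} (h : z ∈ congrSubring W L k) :
    z.2 ∈ (algebraMap W L).range := by
  obtain ⟨a, b, -, -, h₂⟩ := h
  exact ⟨b, h₂⟩

theorem congrSubring_trans {k : ℕ} [FaithfulSMul W L] {a b c : L}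
    (h : (a, b) ∈ congrSubring W L k)
    (h' : (b, c) ∈ congrSubring W L k) : (a, c) ∈ congrSubring W L k := by
  obtain ⟨x, y, hxy, h₁, h₂⟩ := h
  obtain ⟨y', z, hyz, h₁', h₂'⟩ := h'
  obtain rfl : y = y' := FaithfulSMul.algebraMap_injective W L (h₂.trans h₁'.symm)
  exact ⟨x, z, by simpa using add_mem hxy hyz, h₁, h₂'⟩

/-- If `a` is a unit of `W` congruent to `b`, then `b` is a unit and the inverses are congruent. -/
theorem inv_mem_congrSubring {k : ℕ} (hk : 1 ≤ k) [FaithfulSMul W L] {a b : L}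
    (h : (a, b) ∈ congrSubring W L k) (ha : a ≠ 0) (ha' : a⁻¹ ∈ (algebraMap W L).range) :
    b ≠ 0 ∧ (a⁻¹, b⁻¹) ∈ congrSubring W L k := by
  obtain ⟨x, y, hxy, h₁, h₂⟩ := h
  obtain ⟨x', hx'⟩ := ha'
  have inj := FaithfulSMul.algebraMap_injective W L
  have hxx : x * x' = 1 := inj (by rw [map_mul, h₁, hx', map_one, mul_inv_cancel₀ ha])
  have hy : IsUnit y := by
    by_contra hy
    have hxm : x - y ∈ IsLocalRing.maximalIdeal W := Ideal.pow_le_self (by omega) hxy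
    have := add_mem hxm ((IsLocalRing.mem_maximalIdeal y).mpr hy)
    rw [sub_add_cancel] at this
    exact (IsLocalRing.mem_maximalIdeal x).mp this (IsUnit.of_mul_eq_one _ hxx)
  obtain ⟨y', hy'⟩ := hy.exists_right_inv
  have hb : b * algebraMap W L y' = 1 := by
    dsimp only at h₂
    rw [← h₂, ← map_mul, hy', map_one]
  refine ⟨left_ne_zero_of_mul_eq_one hb, x', y', ?_, hx', eq_inv_of_mul_eq_one_right hb⟩
  have : x' - y' = -(x' * y' * (x - y)) := by linear_combination y' * hxx - x' * hy'
  rw [this]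
  exact neg_mem (Ideal.mul_mem_left _ _ hxy)

/-- Elements of `W` congruent to `0` modulo all powers of the maximal ideal vanish, by Krull's
intersection theorem. -/
theorem eq_zero_of_forall_mem_congrSubring [IsNoetherianRing W] [FaithfulSMul W L] {a : L}
    (h : ∀ k, 1 ≤ k → (a, (0 : L)) ∈ congrSubring W L k) : a = 0 := by
  obtain ⟨x, y, -, h₁, -⟩ := h 1 le_rfl
  dsimp only at h₁
  have inj := FaithfulSMul.algebraMap_injective W L
  suffices x = 0 by rw [← h₁, this, map_zero]
  rw [← Ideal.mem_bot, ← Ideal.iInf_pow_eq_bot_of_isLocalRing (IsLocalRing.maximalIdeal W)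
    Ideal.IsPrime.ne_top', Ideal.mem_iInf]
  intro k
  rcases Nat.eq_zero_or_pos k with rfl | hk
  · simp
  obtain ⟨x', y', hxy, h₁', h₂'⟩ := h k hk
  dsimp only at h₁' h₂'
  obtain rfl : x = x' := inj (h₁.trans h₁'.symm)
  obtain rfl : y' = 0 := inj (h₂'.trans (map_zero _).symm)
  simpa using hxy

theorem mem_congrSubring_of_residue_eq {k : ℕ} {a b : W}
    (h : Ideal.Quotient.mk (IsLocalRing.maximalIdeal W ^ k) a =
      Ideal.Quotient.mk (IsLocalRing.maximalIdeal W ^ k) b) :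
    (algebraMap W L a, algebraMap W L b) ∈ congrSubring W L k :=
  ⟨a, b, Ideal.Quotient.eq.mp h, rfl, rfl⟩

end Congruence

/-! ### Finitely many coefficients -/

section Coefficients

variable {K C : Type*} [Field K] [CommRing C] [Algebra K C]

/-- An element of a `K`-algebra generated by `G` is a polynomial in elements of `G` with
coefficients in a ring generated by finitely many elements of `K`. -/
theorem exists_finset_mem_closure {G : Set C} (hG : Algebra.adjoin K G = ⊤) (c : C) :
    ∃ S : Finset K, c ∈ Subring.closure (algebraMap K C '' S ∪ G) := by
  classical
  have mono : ∀ {S T : Finset K}, S ⊆ T → Subring.closure (algebraMap K C '' S ∪ G) ≤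
      Subring.closure (algebraMap K C '' T ∪ G) := fun h ↦
    Subring.closure_mono (Set.union_subset_union_left _ (Set.image_mono h))
  have hc : c ∈ Algebra.adjoin K G := hG ▸ Algebra.mem_top
  induction hc using Algebra.adjoin_induction with
  | mem x hx => exact ⟨∅, Subring.subset_closure (Or.inr hx)⟩
  | algebraMap r => exact ⟨{r}, Subring.subset_closure (Or.inl ⟨r, by simp, rfl⟩)⟩
  | add x y _ _ hx hy =>
    obtain ⟨S, hS⟩ := hx
    obtain ⟨T, hT⟩ := hy
    exact ⟨S ∪ T, add_mem (mono Finset.subset_union_left hS) (mono Finset.subset_union_right hT)⟩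
  | mul x y _ _ hx hy =>
    obtain ⟨S, hS⟩ := hx
    obtain ⟨T, hT⟩ := hy
    exact ⟨S ∪ T, mul_mem (mono Finset.subset_union_left hS) (mono Finset.subset_union_right hT)⟩

/-- The coefficients of a finite family of elements can be taken from one finite set. -/
theorem exists_finset_forall_mem_closure {G : Set C} (hG : Algebra.adjoin K G = ⊤)
    {ι : Type*} [Finite ι] (c : ι → C) :
    ∃ S : Finset K, ∀ i, c i ∈ Subring.closure (algebraMap K C '' S ∪ G) := by
  classical
  have := Fintype.ofFinite ι
  choose S hS using fun i ↦ exists_finset_mem_closure hG (c i)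
  refine ⟨Finset.univ.biUnion S, fun i ↦ Subring.closure_mono (Set.union_subset_union_left _
    (Set.image_mono ?_)) (hS i)⟩
  exact_mod_cast Finset.subset_biUnion_of_mem S (Finset.mem_univ i)

theorem map_mem_of_mem_closure {S : Set K} {G : Set C} {c : C}
    (hc : c ∈ Subring.closure (algebraMap K C '' S ∪ G)) {A : Type*} [CommRing A] (θ : C →+* A)
    (D : Subring A) (hS : ∀ a ∈ S, θ (algebraMap K C a) ∈ D) (hG : ∀ g ∈ G, θ g ∈ D) :
    θ c ∈ D := by
  suffices Subring.closure (algebraMap K C '' S ∪ G) ≤ D.comap θ from this hc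
  rw [Subring.closure_le]
  rintro _ (⟨a, ha, rfl⟩ | hg)
  · exact hS a ha
  · exact hG _ hg

end Coefficients

/-! ### Lifting congruences along unramified maps -/

section Unramified

open scoped TensorProduct

variable {K A C : Type*} [Field K] [CommRing A] [CommRing C] [Algebra K A] [Algebra K C]
  [Algebra A C] [IsScalarTower K A C]

/-- The kernel of `C ⊗[K] C → C ⊗[A] C` is generated by the elements `1 ⊗ a - a ⊗ 1` for `a` in a
set of generators of the `K`-algebra `A`. -/
theorem mem_span_of_map_tensor_eq_zero {ι : Type*} {a : ι → A}
    (ha : Algebra.adjoin K (Set.range a) = ⊤) (z : C ⊗[K] C)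
    (hz : Algebra.TensorProduct.mapOfCompatibleSMul A K K C C z = 0) :
    z ∈ Ideal.span (Set.range fun i ↦
      (1 : C) ⊗ₜ[K] algebraMap A C (a i) - algebraMap A C (a i) ⊗ₜ[K] (1 : C)) := by
  set I := Ideal.span (Set.range fun i ↦
      (1 : C) ⊗ₜ[K] algebraMap A C (a i) - algebraMap A C (a i) ⊗ₜ[K] (1 : C))
  let l : C →ₐ[K] (C ⊗[K] C) ⧸ I :=
    (Ideal.Quotient.mkₐ K I).comp Algebra.TensorProduct.includeLeft
  let r : C →ₐ[K] (C ⊗[K] C) ⧸ I :=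
    (Ideal.Quotient.mkₐ K I).comp Algebra.TensorProduct.includeRight
  have hlr : l.comp (IsScalarTower.toAlgHom K A C) = r.comp (IsScalarTower.toAlgHom K A C) := by
    refine AlgHom.ext_of_adjoin_eq_top ha ?_
    rintro _ ⟨i, rfl⟩
    refine (Ideal.Quotient.eq.mpr ?_ : Ideal.Quotient.mk I _ = Ideal.Quotient.mk I _)
    rw [← neg_sub]
    exact neg_mem (Ideal.subset_span ⟨i, rfl⟩)
  -- `l` and `r` agree on `A`, so they induce a map on `C ⊗[A] C`
  let lA : C →ₐ[A] (C ⊗[K] C) ⧸ I := { l with commutes' := fun _ ↦ rfl }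
  let rA : C →ₐ[A] (C ⊗[K] C) ⧸ I := { r with commutes' := fun x ↦ (congr($hlr x)).symm }
  let θ : C ⊗[A] C →ₐ[A] (C ⊗[K] C) ⧸ I :=
    Algebra.TensorProduct.lift lA rA fun _ _ ↦ Commute.all _ _
  have hθ : ∀ w : C ⊗[K] C, θ (Algebra.TensorProduct.mapOfCompatibleSMul A K K C C w) =
      Ideal.Quotient.mk I w := by
    intro w
    induction w with
    | zero => simp
    | add x y hx hy => simp only [map_add, hx, hy]
    | tmul x y =>
      rw [Algebra.TensorProduct.mapOfCompatibleSMul_tmul, Algebra.TensorProduct.lift_tmul]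
      change Ideal.Quotient.mk I (x ⊗ₜ 1) * Ideal.Quotient.mk I (1 ⊗ₜ y) = _
      rw [← map_mul, Algebra.TensorProduct.tmul_mul_tmul, mul_one, one_mul]
  rw [← Ideal.Quotient.eq_zero_iff_mem, ← hθ, hz, map_zero]

/-- Let `C` be unramified over `A`. For all local rings `W ⊆ L` containing a suitable finite set of
elements of `K`, two `W`-integral points of `Spec C` that are congruent modulo the maximal ideal
of `W`, and whose images in `Spec A` are congruent modulo its `k`-th power, are congruent modulo
this power.

Indeed there is `e` in `C ⊗[K] C` that specializes to `1` on the diagonal and such that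
`(1 ⊗ c - c ⊗ 1) * e` lies in the ideal generated by the differences `1 ⊗ a - a ⊗ 1` with `a` in
`A`; at a pair of points congruent modulo the maximal ideal, `e` takes a unit as value. -/
theorem exists_finset_congr_of_unramified [Algebra.FormallyUnramified A C]
    {ι κ : Type*} [Finite ι] [Finite κ] {a : ι → A} (ha : Algebra.adjoin K (Set.range a) = ⊤)
    {g : κ → C} (hg : Algebra.adjoin K (Set.range g) = ⊤) :
    ∃ S : Finset K, ∀ (L W : Type u) [Field L] [CommRing W] [IsLocalRing W] [Algebra W L]
      [FaithfulSMul W L] [Algebra K L],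
      (∀ s ∈ S, algebraMap K L s ∈ (algebraMap W L).range) → ∀ (φ ψ : C →ₐ[K] L),
      (∀ j, (φ (g j), ψ (g j)) ∈ congrSubring W L 1) → ∀ k,
      (∀ i, (φ (algebraMap A C (a i)), ψ (algebraMap A C (a i))) ∈ congrSubring W L k) →
      ∀ j, (φ (g j), ψ (g j)) ∈ congrSubring W L k := by
  have : Algebra.FiniteType K C := ⟨⟨(Set.finite_range g).toFinset, by simpa using hg⟩⟩
  have : Algebra.FiniteType A C := .of_restrictScalars_finiteType K A C
  obtain ⟨e₀, he₀, he₀'⟩ := Algebra.FormallyUnramified.iff_exists_tensorProduct.mp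
    ‹Algebra.FormallyUnramified A C›
  let π := Algebra.TensorProduct.mapOfCompatibleSMul A K K C C
  obtain ⟨e, rfl⟩ : ∃ e, π e = e₀ :=
    Algebra.TensorProduct.mapOfCompatibleSMul_surjective A K K C C e₀
  have hcomb : ∀ j, ∃ q : ι →₀ C ⊗[K] C,
      (q.sum fun i r ↦ r * ((1 : C) ⊗ₜ[K] algebraMap A C (a i) -
        algebraMap A C (a i) ⊗ₜ[K] (1 : C))) =
        ((1 : C) ⊗ₜ[K] g j - g j ⊗ₜ[K] (1 : C)) * e := by
    intro j
    have := mem_span_of_map_tensor_eq_zero ha (((1 : C) ⊗ₜ[K] g j - g j ⊗ₜ[K] (1 : C)) * e)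
      (by rw [map_mul, map_sub]; simpa using he₀ (g j))
    exact Finsupp.mem_ideal_span_range_iff_exists_finsupp.mp this
  choose q hq using hcomb
  -- generators of the `K`-algebra `C ⊗[K] C`
  let G : Set (C ⊗[K] C) := (Set.range fun j ↦ g j ⊗ₜ[K] 1) ∪ Set.range fun j ↦ 1 ⊗ₜ[K] g j
  have hG : Algebra.adjoin K G = ⊤ := by
    have h₁ : (Algebra.TensorProduct.includeLeft : C →ₐ[K] C ⊗[K] C).range ≤
        Algebra.adjoin K G := by
      rw [← Algebra.map_top, ← hg, AlgHom.map_adjoin]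
      refine Algebra.adjoin_mono ?_
      rintro _ ⟨_, ⟨j, rfl⟩, rfl⟩
      exact Or.inl ⟨j, rfl⟩
    have h₂ : (Algebra.TensorProduct.includeRight : C →ₐ[K] C ⊗[K] C).range ≤
        Algebra.adjoin K G := by
      rw [← Algebra.map_top, ← hg, AlgHom.map_adjoin]
      refine Algebra.adjoin_mono ?_
      rintro _ ⟨_, ⟨j, rfl⟩, rfl⟩
      exact Or.inr ⟨j, rfl⟩
    rw [eq_top_iff]
    rintro z -
    induction z with
    | zero => exact zero_mem _
    | add x y hx hy => exact add_mem hx hy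
    | tmul x y =>
      rw [show x ⊗ₜ[K] y = (x ⊗ₜ[K] 1) * (1 ⊗ₜ[K] y) by simp]
      exact mul_mem (h₁ ⟨x, rfl⟩) (h₂ ⟨y, rfl⟩)
  obtain ⟨S₁, hS₁⟩ := exists_finset_mem_closure hG e
  obtain ⟨S₂, hS₂⟩ := exists_finset_forall_mem_closure hG fun p : κ × ι ↦ q p.1 p.2
  classical
  refine ⟨S₁ ∪ S₂, ?_⟩
  intro L W _ _ _ _ _ _ hS φ ψ h1 k hk j
  let E : C ⊗[K] C →ₐ[K] L := Algebra.TensorProduct.lift φ ψ fun _ _ ↦ Commute.all _ _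
  let E' : C ⊗[K] C →ₐ[K] L := Algebra.TensorProduct.lift φ φ fun _ _ ↦ Commute.all _ _
  have hE' : E' e = 1 := by
    have hE : ∀ w, E' w = φ (Algebra.TensorProduct.lmul' A (S := C) (π w)) := by
      intro w
      induction w with
      | zero => simp
      | add x y hx hy => simp only [map_add, hx, hy]
      | tmul x y => simp [E', π]
    rw [hE, he₀', map_one]
  -- `e` takes at the pair `(φ, ψ)` a value congruent to its value `1` at `(φ, φ)`
  have hpair : (E e, E' e) ∈ congrSubring W L 1 := by
    refine map_mem_of_mem_closure hS₁ (E.toRingHom.prod E'.toRingHom) (congrSubring W L 1) ?_ ?_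
    · intro s hs
      have : (E.toRingHom.prod E'.toRingHom) (algebraMap K _ s) =
          (algebraMap K L s, algebraMap K L s) :=
        Prod.ext (E.commutes s) (E'.commutes s)
      rw [this]
      exact diag_mem_congrSubring (hS s (Finset.mem_union_left _ hs))
    · rintro _ (⟨j, rfl⟩ | ⟨j, rfl⟩)
      · have : (E.toRingHom.prod E'.toRingHom) (g j ⊗ₜ[K] 1) = (φ (g j), φ (g j)) := by
          ext <;> simp [E, E']
        rw [this]
        exact diag_mem_congrSubring (fst_mem_range_of_mem_congrSubring (h1 j))
      · have : (E.toRingHom.prod E'.toRingHom) (1 ⊗ₜ[K] g j) = (ψ (g j), φ (g j)) := by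
          ext <;> simp [E, E']
        rw [this]
        exact swap_mem_congrSubring (h1 j)
  have hqW : ∀ j i, E (q j i) ∈ (algebraMap W L).range := by
    intro j i
    refine map_mem_of_mem_closure (hS₂ (j, i)) E.toRingHom _ ?_ ?_
    · intro s hs
      rw [AlgHom.toRingHom_eq_coe, RingHom.coe_coe, E.commutes]
      exact hS s (Finset.mem_union_right _ hs)
    · rintro _ (⟨j, rfl⟩ | ⟨j, rfl⟩)
      · have : E.toRingHom (g j ⊗ₜ[K] 1) = φ (g j) := by simp [E]
        rw [this]
        exact fst_mem_range_of_mem_congrSubring (h1 j)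
      · have : E.toRingHom (1 ⊗ₜ[K] g j) = ψ (g j) := by simp [E]
        rw [this]
        exact snd_mem_range_of_mem_congrSubring (h1 j)
  obtain ⟨hEe, hEinv⟩ : E e ≠ 0 ∧ (1⁻¹, (E e)⁻¹) ∈ congrSubring W L 1 := by
    rw [hE'] at hpair
    exact inv_mem_congrSubring le_rfl (swap_mem_congrSubring hpair) one_ne_zero
      ⟨1, by simp⟩
  have hmain : (ψ (g j) - φ (g j), 0) ∈ congrSubring W L k := by
    have key : ψ (g j) - φ (g j) = (E e)⁻¹ * (q j).sum fun i r ↦ E r *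
        (ψ (algebraMap A C (a i)) - φ (algebraMap A C (a i))) := by
      have h₁ : ∀ c : C, E (1 ⊗ₜ[K] c - c ⊗ₜ[K] 1) = ψ c - φ c := fun c ↦ by simp [E]
      have := congrArg E (hq j)
      rw [map_mul, h₁, map_finsuppSum] at this
      rw [eq_inv_mul_iff_mul_eq₀ hEe, mul_comm, ← this]
      simp only [map_mul, h₁]
    rw [key]
    have hz : ∀ {r b : L}, r ∈ (algebraMap W L).range → (b, (0 : L)) ∈ congrSubring W L k →
        (r * b, (0 : L)) ∈ congrSubring W L k := fun {r b} hr hb ↦ by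
      simpa using mul_mem (diag_mem_congrSubring (k := k) hr) hb
    refine hz (snd_mem_range_of_mem_congrSubring hEinv) ?_
    have hs : ((q j).sum fun i r ↦ E r * (ψ (algebraMap A C (a i)) - φ (algebraMap A C (a i))),
        (0 : L)) = ∑ i ∈ (q j).support,
          (E (q j i) * (ψ (algebraMap A C (a i)) - φ (algebraMap A C (a i))), (0 : L)) := by
      ext
      · simp [Finsupp.sum, Prod.fst_sum]
      · simp [Prod.snd_sum]
    rw [hs]
    refine sum_mem fun i _ ↦ hz (hqW j i) ?_
    simpa using sub_mem (swap_mem_congrSubring (hk i))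
      (diag_mem_congrSubring (fst_mem_range_of_mem_congrSubring (hk i)))
  have := add_mem hmain (diag_mem_congrSubring (k := k)
    (fst_mem_range_of_mem_congrSubring (h1 j)))
  refine swap_mem_congrSubring ?_
  simpa using this

end Unramified

/-! ### A place of good reduction -/

open NumberField in
/-- A finite set of elements of a number field `K` is integral at all places above some prime
number `p`. The residue fields of these places in the extensions of degree at most `d` have
bounded cardinality. -/
theorem exists_localRing_of_finset (K : Type u) [Field K] [NumberField K] (d : ℕ) (S : Finset K) :
    ∃ Q : ℕ, ∀ (L : Type u) [Field L] [Algebra K L] [FiniteDimensional K L],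
      Module.finrank K L ≤ d → ∃ (W : Type u) (_ : CommRing W) (_ : IsDomain W)
        (_ : IsDiscreteValuationRing W) (_ : Algebra W L) (_ : IsFractionRing W L),
        Finite (W ⧸ IsLocalRing.maximalIdeal W) ∧
        Nat.card (W ⧸ IsLocalRing.maximalIdeal W) ≤ Q ∧
        ∀ s ∈ S, algebraMap K L s ∈ (algebraMap W L).range := by
  have : Algebra.IsAlgebraic ℤ K := (IsFractionRing.comap_isAlgebraic_iff (A := ℤ) (K := ℚ)).mpr
    inferInstance
  obtain ⟨N, hN, hNS⟩ := Algebra.IsAlgebraic.exists_integral_multiples ℤ S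
  obtain ⟨p, hpN, hp⟩ := Nat.exists_infinite_primes (N.natAbs + 1)
  have hpN' : ¬ (p : ℤ) ∣ N := fun h ↦ by
    have := Nat.le_of_dvd (Int.natAbs_pos.mpr hN) (Int.natCast_dvd.mp h)
    omega
  have hpZ : Prime (p : ℤ) := Nat.prime_iff_prime_int.mp hp
  refine ⟨p ^ (Module.finrank ℚ K * d), ?_⟩
  intro L _ _ _ hd
  have : CharZero L := charZero_of_injective_algebraMap (algebraMap K L).injective
  have : FiniteDimensional ℚ L := FiniteDimensional.trans ℚ K L
  have : NumberField L := {}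
  have hmax : (Ideal.span {(p : ℤ)}).IsMaximal :=
    PrincipalIdealRing.isMaximal_of_irreducible hpZ.irreducible
  obtain ⟨P, hP, hPp⟩ := Ideal.exists_maximal_ideal_liesOver_of_isIntegral (S := 𝓞 L)
    (Ideal.span {(p : ℤ)})
  have hmem : ∀ n : ℤ, (n : 𝓞 L) ∈ P ↔ (p : ℤ) ∣ n := fun n ↦ by
    rw [← Ideal.mem_span_singleton, Ideal.mem_of_liesOver P (Ideal.span {(p : ℤ)})]
    simp
  have hP0 : P ≠ ⊥ := by
    rintro rfl
    have := (hmem p).mpr dvd_rfl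
    simp [hp.ne_zero] at this
  have hcard : Nat.card (𝓞 L ⧸ P) ≤ p ^ (Module.finrank ℚ K * d) := by
    have h₁ : Ideal.absNorm P ∣ Ideal.absNorm (Ideal.span {((p : ℤ) : 𝓞 L)}) :=
      Ideal.absNorm_dvd_absNorm_of_le
        ((Ideal.span_singleton_le_iff_mem _).mpr ((hmem p).mpr dvd_rfl))
    have h₂ : Ideal.absNorm (Ideal.span {((p : ℤ) : 𝓞 L)}) = p ^ Module.finrank ℚ L := by
      rw [Ideal.absNorm_span_singleton,
        show ((p : ℤ) : 𝓞 L) = algebraMap ℤ (𝓞 L) p by simp, Algebra.norm_algebraMap,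
        RingOfIntegers.rank]
      simp [Int.natAbs_pow]
    rw [h₂] at h₁
    calc Nat.card (𝓞 L ⧸ P) ≤ p ^ Module.finrank ℚ L := Nat.le_of_dvd (pow_pos hp.pos _) h₁
      _ ≤ _ := Nat.pow_le_pow_right hp.pos (by
        rw [← Module.finrank_mul_finrank ℚ K L]
        exact Nat.mul_le_mul_left _ hd)
  let W := Localization.AtPrime P
  let f : W →+* L := IsLocalization.map L (T := nonZeroDivisors (𝓞 L)) (RingHom.id (𝓞 L))
    P.primeCompl_le_nonZeroDivisors
  algebraize [f]
  have : IsScalarTower (𝓞 L) W L := IsScalarTower.of_algebraMap_eq'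
    ((IsLocalization.map_comp P.primeCompl_le_nonZeroDivisors).trans (RingHom.comp_id _)).symm
  have hfrac : IsFractionRing W L :=
    IsFractionRing.isFractionRing_of_isDomain_of_isLocalization P.primeCompl W L
  have e := IsLocalization.AtPrime.equivQuotMaximalIdeal P W
  have hfin : Finite (𝓞 L ⧸ P) := Ideal.finiteQuotientOfFreeOfNeBot P hP0
  refine ⟨W, inferInstance, inferInstance,
    IsLocalization.AtPrime.isDiscreteValuationRing_of_dedekind_domain _ hP0 _, inferInstance,
    hfrac, .of_equiv _ e.toEquiv, (Nat.card_congr e.toEquiv).symm.trans_le hcard, ?_⟩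
  intro s hs
  have hint : IsIntegral ℤ (algebraMap K L (N • s)) := (hNS s hs).algebraMap
  have hu : IsUnit (algebraMap (𝓞 L) W N) :=
    IsLocalization.map_units W (⟨(N : 𝓞 L), fun h ↦ hpN' ((hmem N).mp h)⟩ : P.primeCompl)
  obtain ⟨w, hw⟩ := hu.exists_right_inv
  obtain ⟨b, hb⟩ : ∃ b : 𝓞 L, algebraMap (𝓞 L) L b = algebraMap K L (N • s) := ⟨⟨_, hint⟩, rfl⟩
  refine ⟨algebraMap (𝓞 L) W b * w, ?_⟩
  have hw' := congrArg (algebraMap W L) hw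
  rw [map_mul, map_one, ← IsScalarTower.algebraMap_apply] at hw'
  rw [map_mul, ← IsScalarTower.algebraMap_apply, hb]
  simp only [zsmul_eq_mul, map_mul, map_intCast] at hw' ⊢
  linear_combination algebraMap K L s * hw'

/-! ### Field-valued points of projective space -/

section Proj

open HomogeneousLocalization

variable {σ A : Type u} [CommRing A] [SetLike σ A] [AddSubgroupClass σ A] {𝒜 : ℕ → σ}
  [GradedRing 𝒜] {f g : A} (hf : f ∈ 𝒜 1) (hg : g ∈ 𝒜 1) {L : Type u} [Field L]

/-- The quotient `g / f` of two elements of degree one, as a function on `D₊(f)`. -/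
def awayRatio {f g : A} (hf : f ∈ 𝒜 1) (hg : g ∈ 𝒜 1) : Away 𝒜 f :=
  Away.mk 𝒜 hf 1 g (by simpa using hg)

theorem val_awayRatio : (awayRatio hf hg).val =
    Localization.mk g (⟨f ^ 1, 1, rfl⟩ : Submonoid.powers f) := rfl

theorem awayRatio_self : awayRatio hf hf = 1 := by
  ext
  simp [val_awayRatio]

theorem algebraMap_mul_val_awayRatio :
    algebraMap A (Localization.Away f) f * (awayRatio hf hg).val =
      algebraMap A (Localization.Away f) g := by
  rw [val_awayRatio, ← Localization.mk_one_eq_algebraMap, ← Localization.mk_one_eq_algebraMap,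
    Localization.mk_mul, Localization.mk_eq_mk_iff, Localization.r_iff_exists]
  exact ⟨1, by simp [mul_comm]⟩

/-- A field-valued point of `D₊(f)` at which `g / f` does not vanish lies in `D₊(g)`. -/
theorem exists_comp_awayι_eq (φ : CommRingCat.of (Away 𝒜 f) ⟶ .of L)
    (h : φ (awayRatio hf hg) ≠ 0) :
    ∃ φ' : CommRingCat.of (Away 𝒜 g) ⟶ .of L,
      Spec.map φ' ≫ Proj.awayι 𝒜 g hg one_pos = Spec.map φ ≫ Proj.awayι 𝒜 f hf one_pos := by
  let := (awayMap 𝒜 hg (rfl : f * g = _)).toAlgebra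
  have := Away.isLocalization_mul hf hg rfl one_ne_zero
  have he : Away.isLocalizationElem hf hg = awayRatio hf hg := by
    ext
    simp [awayRatio]
  have hu : IsUnit (φ.hom (Away.isLocalizationElem hf hg)) := by
    rw [he]
    exact Ne.isUnit h
  obtain ⟨χ, hχ'⟩ : ∃ χ : Away 𝒜 (f * g) →+* L, χ.comp (awayMap 𝒜 hg rfl) = φ.hom :=
    ⟨IsLocalization.Away.lift _ hu, IsLocalization.Away.lift_comp _ hu⟩
  have hχ : Spec.map φ = Spec.map (CommRingCat.ofHom χ) ≫
      Spec.map (CommRingCat.ofHom (awayMap 𝒜 hg rfl)) := by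
    rw [← Spec.map_comp, ← CommRingCat.ofHom_comp, hχ', CommRingCat.ofHom_hom]
  refine ⟨CommRingCat.ofHom (awayMap 𝒜 hf (mul_comm _ _)) ≫ CommRingCat.ofHom χ, ?_⟩
  rw [hχ, Spec.map_comp, Category.assoc, Category.assoc, Proj.SpecMap_awayMap_awayι,
    Proj.SpecMap_awayMap_awayι]

theorem map_awayRatio_eq_mul (φ : CommRingCat.of (Away 𝒜 f) ⟶ .of L)
    (φ' : CommRingCat.of (Away 𝒜 g) ⟶ .of L)
    (h : Spec.map φ ≫ Proj.awayι 𝒜 f hf one_pos = Spec.map φ' ≫ Proj.awayι 𝒜 g hg one_pos)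
    {a : A} (ha : a ∈ 𝒜 1) :
    φ (awayRatio hf ha) = φ (awayRatio hf hg) * φ' (awayRatio hg ha) := by
  obtain ⟨χ, hχ⟩ := Spec.homEquiv.symm.surjective (pullback.lift _ _ h ≫
    (Proj.pullbackAwayιIso 𝒜 hf one_pos hg one_pos (rfl : f * g = _)).hom)
  have h₁ : φ = CommRingCat.ofHom (awayMap 𝒜 hg (rfl : f * g = _)) ≫ χ := by
    apply Spec.map_injective
    rw [Spec.map_comp]
    change _ = Spec.homEquiv.symm χ ≫ _
    rw [hχ, Category.assoc, Proj.pullbackAwayιIso_hom_SpecMap_awayMap_left, pullback.lift_fst]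
  have h₂ : φ' = CommRingCat.ofHom (awayMap 𝒜 hf (mul_comm f g)) ≫ χ := by
    apply Spec.map_injective
    rw [Spec.map_comp]
    change _ = Spec.homEquiv.symm χ ≫ _
    rw [hχ, Category.assoc, Proj.pullbackAwayιIso_hom_SpecMap_awayMap_right, pullback.lift_snd]
  have h₃ : awayMap 𝒜 hg (rfl : f * g = _) (awayRatio hf ha) =
      awayMap 𝒜 hg (rfl : f * g = _) (awayRatio hf hg) *
        awayMap 𝒜 hf (mul_comm f g) (awayRatio hg ha) := by
    simp only [awayRatio, awayMap_mk]
    ext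
    rw [val_mul, Away.val_mk, Away.val_mk, Away.val_mk, Localization.mk_mul,
      Localization.mk_eq_mk_iff, Localization.r_iff_exists]
    refine ⟨1, ?_⟩
    simp
    ring
  rw [h₁, h₂]
  simpa using congrArg χ.hom h₃

end Proj

section ProjectiveSpace

attribute [local instance] MvPolynomial.gradedAlgebra

open HomogeneousLocalization MvPolynomial

variable (K : Type u) [Field K] (n : ℕ)

theorem X_mem_homogeneousSubmodule_one (i : Fin (n + 1)) :
    (X i : MvPolynomial (Fin (n + 1)) K) ∈ homogeneousSubmodule (Fin (n + 1)) K 1 :=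
  isHomogeneous_X K i

/-- The ring of functions on the standard affine open `xᵢ ≠ 0` of projective space. -/
noncomputable abbrev stdRing (i : Fin (n + 1)) : CommRingCat.{u} :=
  .of (Away (homogeneousSubmodule (Fin (n + 1)) K) (X i))

/-- The standard affine open `xᵢ ≠ 0` of projective space. -/
noncomputable abbrev stdChart (i : Fin (n + 1)) : Spec (stdRing K n i) ⟶
    Proj (homogeneousSubmodule (Fin (n + 1)) K) :=
  Proj.awayι (homogeneousSubmodule (Fin (n + 1)) K) (X i)
    (X_mem_homogeneousSubmodule_one K n i) one_pos

/-- The coordinate `xₘ / xᵢ` on the standard affine open `xᵢ ≠ 0`. -/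
noncomputable def stdCoord (i m : Fin (n + 1)) : stdRing K n i :=
  awayRatio (X_mem_homogeneousSubmodule_one K n i) (X_mem_homogeneousSubmodule_one K n m)

/-- The structure morphism of the standard affine open `xᵢ ≠ 0`. -/
noncomputable def stdConst (i : Fin (n + 1)) : K →+* stdRing K n i :=
  (fromZeroRingHom (homogeneousSubmodule (Fin (n + 1)) K) _).comp
    (algebraMap K (homogeneousSubmodule (Fin (n + 1)) K 0))

theorem stdChart_comp_projSpaceToSpec (i : Fin (n + 1)) :
    stdChart K n i ≫ projSpaceToSpec K n = Spec.map (CommRingCat.ofHom (stdConst K n i)) := by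
  rw [projSpaceToSpec, stdConst, CommRingCat.ofHom_comp, Spec.map_comp]
  exact Proj.awayι_toSpecZero_assoc ..

variable {K n}

theorem eval₂_mul_of_isHomogeneous {σ R S : Type*} [CommRing R] [CommRing S] {N : ℕ}
    {F : MvPolynomial σ R} (hF : F.IsHomogeneous N) (f : R →+* S) (u : S) (w : σ → S) :
    eval₂ f (fun m ↦ u * w m) F = u ^ N * eval₂ f w F := by
  rw [eval₂_eq, eval₂_eq, Finset.mul_sum]
  refine Finset.sum_congr rfl fun d hd ↦ ?_
  have : ∑ m ∈ d.support, d m = N := by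
    rw [← hF (mem_support_iff.mp hd), Finsupp.weight_apply, Finsupp.sum]
    simp
  simp only [mul_pow, Finset.prod_mul_distrib, Finset.prod_pow_eq_pow_sum, this]
  ring

/-- Every function on `xᵢ ≠ 0` is a polynomial in the coordinates `xₘ / xᵢ`. -/
theorem stdRing_mem_closure (i : Fin (n + 1)) (a : stdRing K n i) :
    a ∈ Subring.closure (Set.range (stdConst K n i) ∪ Set.range (stdCoord K n i)) := by
  obtain ⟨N, F, hF, rfl⟩ := Away.mk_surjective _ (X_mem_homogeneousSubmodule_one K n i) a
  have hF' : F.IsHomogeneous N := by simpa using hF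
  let l := algebraMap (MvPolynomial (Fin (n + 1)) K)
    (Localization.Away (X i : MvPolynomial (Fin (n + 1)) K))
  have hcoord : ∀ m, l (X i) * (stdCoord K n i m).val = l (X m) := fun m ↦
    algebraMap_mul_val_awayRatio _ _
  have key : Away.mk (homogeneousSubmodule (Fin (n + 1)) K)
      (X_mem_homogeneousSubmodule_one K n i) N F hF =
        eval₂ (stdConst K n i) (stdCoord K n i) F := by
    ext
    have h₁ : (eval₂ (stdConst K n i) (stdCoord K n i) F).val =
        eval₂ (l.comp C) (fun m ↦ (stdCoord K n i m).val) F :=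
      hom_eval₂ F (stdConst K n i) (algebraMap (stdRing K n i) _) (stdCoord K n i)
    have h₂ : l F = l (X i) ^ N * eval₂ (l.comp C) (fun m ↦ (stdCoord K n i m).val) F := by
      rw [← eval₂_mul_of_isHomogeneous hF']
      simp only [hcoord]
      exact (congrArg l (eval₂_eta F)).symm.trans (hom_eval₂ F C l X)
    rw [h₁, Away.val_mk, Localization.mk_eq_mk', IsLocalization.mk'_eq_iff_eq_mul, mul_comm]
    exact h₂.trans (congrArg (· * _) (map_pow l _ _).symm)
  rw [key]
  generalize F = G
  induction G using MvPolynomial.induction_on with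
  | C a =>
    rw [eval₂_C]
    exact Subring.subset_closure (Or.inl ⟨a, rfl⟩)
  | add p q hp hq =>
    rw [eval₂_add]
    exact add_mem hp hq
  | mul_X p m hp =>
    rw [eval₂_mul, eval₂_X]
    exact mul_mem hp (Subring.subset_closure (Or.inr ⟨m, rfl⟩))

theorem exists_mem_range_stdChart (x : Proj (homogeneousSubmodule (Fin (n + 1)) K)) :
    ∃ i, x ∈ Set.range (stdChart K n i) := by
  let 𝒜 := homogeneousSubmodule (Fin (n + 1)) K
  have hadj : Algebra.adjoin (𝒜 0) (Set.range (X : Fin (n + 1) → MvPolynomial _ K)) = ⊤ := by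
    refine top_unique fun p _ ↦ ?_
    induction p using MvPolynomial.induction_on with
    | C a => exact Subalgebra.algebraMap_mem _ (⟨C a, isHomogeneous_C _ a⟩ : 𝒜 0)
    | add p q hp hq => exact add_mem (hp trivial) (hq trivial)
    | mul_X p m hp => exact mul_mem (hp trivial) (Algebra.subset_adjoin ⟨m, rfl⟩)
  have := Proj.iSup_basicOpen_eq_top' 𝒜 (X : Fin (n + 1) → MvPolynomial _ K)
    (fun i ↦ ⟨1, isHomogeneous_X K i⟩) hadj
  obtain ⟨i, hi⟩ := TopologicalSpace.Opens.mem_iSup.mp (this.ge (Set.mem_univ x))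
  rw [← Proj.opensRange_awayι 𝒜 (X i) (X_mem_homogeneousSubmodule_one K n i) one_pos] at hi
  exact ⟨i, hi⟩

end ProjectiveSpace

/-! ### Affine charts of a projective scheme -/

/-- The properties, used here, of the cover of a closed subscheme `X` of projective space by the
affine opens `xᵢ ≠ 0`: the chart `c i` has coordinate ring `B i`, generated by the functions
`t i m = xₘ / xᵢ`, and the transition rules hold at field-valued points. -/
structure ProjAtlas {K : Type u} [Field K] {X : Scheme.{u}} (p : X ⟶ Spec (CommRingCat.of K)) where
  n : ℕ
  B : Fin (n + 1) → CommRingCat.{u}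
  [algebra : ∀ i, Algebra K (B i)]
  c : ∀ i, Spec (B i) ⟶ X
  [isOpenImmersion : ∀ i, IsOpenImmersion (c i)]
  c_comp : ∀ i, c i ≫ p = Spec.map (CommRingCat.ofHom (algebraMap K (B i)))
  cover : ∀ x : X, ∃ i, x ∈ Set.range (c i)
  t : ∀ i, Fin (n + 1) → B i
  adjoin_range_t : ∀ i, Algebra.adjoin K (Set.range (t i)) = ⊤
  t_self : ∀ i, t i i = 1
  exists_comp_eq : ∀ {L : Type u} [Field L] {i j : Fin (n + 1)} (φ : B i ⟶ .of L), φ (t i j) ≠ 0 →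
    ∃ φ' : B j ⟶ .of L, Spec.map φ' ≫ c j = Spec.map φ ≫ c i
  map_t_eq_mul : ∀ {L : Type u} [Field L] {i j : Fin (n + 1)} (φ : B i ⟶ .of L)
    (φ' : B j ⟶ .of L), Spec.map φ ≫ c i = Spec.map φ' ≫ c j →
    ∀ m, φ (t i m) = φ (t i j) * φ' (t j m)

attribute [instance] ProjAtlas.algebra ProjAtlas.isOpenImmersion

/-- A closed subscheme restricts to a closed subscheme `Spec B` of an affine chart. -/
theorem exists_isPullback_Spec {X P : Scheme.{u}} (j : X ⟶ P) [IsClosedImmersion j]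
    {A : CommRingCat.{u}} (a : Spec A ⟶ P) :
    ∃ (B : CommRingCat.{u}) (c : Spec B ⟶ X) (π : A ⟶ B),
      Function.Surjective π ∧ IsPullback c (Spec.map π) j a := by
  obtain ⟨I, e, h⟩ := (IsClosedImmersion.Spec_iff (f := pullback.snd j a)).mp
    inferInstance
  refine ⟨.of (A ⧸ I), e.inv ≫ pullback.fst j a, CommRingCat.ofHom (Ideal.Quotient.mk I),
    Ideal.Quotient.mk_surjective, ?_⟩
  refine .of_iso_pullback ⟨?_⟩ e.symm rfl ?_
  · rw [Category.assoc, pullback.condition, h, Category.assoc, e.inv_hom_id_assoc]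
  · rw [Iso.symm_hom, h, e.inv_hom_id_assoc]

section ProjectiveSpace

attribute [local instance] MvPolynomial.gradedAlgebra

theorem nonempty_projAtlas_of_isClosedImmersion {K : Type u} [Field K] {X : Scheme.{u}} {n : ℕ}
    (j : X ⟶ Proj (MvPolynomial.homogeneousSubmodule (Fin (n + 1)) K)) [IsClosedImmersion j]
    (q : Proj (MvPolynomial.homogeneousSubmodule (Fin (n + 1)) K) ⟶ Spec (CommRingCat.of K))
    (hq : ∀ i, stdChart K n i ≫ q = Spec.map (CommRingCat.ofHom (stdConst K n i))) :
    Nonempty (ProjAtlas (j ≫ q)) := by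
  choose B c π hπ h using fun i ↦ exists_isPullback_Spec j (stdChart K n i)
  have hx := X_mem_homogeneousSubmodule_one K n
  let alg : ∀ i, Algebra K (B i) := fun i ↦ ((π i).hom.comp (stdConst K n i)).toAlgebra
  have hcomp : ∀ {L : Type u} [Field L] {i : Fin (n + 1)} (φ : B i ⟶ .of L),
      Spec.map φ ≫ c i ≫ j = Spec.map (π i ≫ φ) ≫ stdChart K n i := fun φ ↦ by
    rw [(h _).w, Spec.map_comp, Category.assoc]
  refine ⟨{
    n := n
    B := B
    c := c
    isOpenImmersion := fun i ↦ ?_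
    c_comp := fun i ↦ ?_
    cover := fun x ↦ ?_
    t := fun i m ↦ π i (stdCoord K n i m)
    adjoin_range_t := fun i ↦ ?_
    t_self := fun i ↦ ?_
    exists_comp_eq := fun {L} _ {i i'} φ hφ ↦ ?_
    map_t_eq_mul := fun {L} _ {i i'} φ φ' hφ m ↦ ?_ }⟩
  · exact MorphismProperty.of_isPullback (P := @IsOpenImmersion) (h i).flip inferInstance
  · rw [← Category.assoc, (h i).w, Category.assoc, hq, ← Spec.map_comp]
    rfl
  · obtain ⟨i, y, hy⟩ := exists_mem_range_stdChart (j x)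
    obtain ⟨z, hz, -⟩ := Scheme.Pullback.exists_preimage_pullback x y hy.symm
    refine ⟨i, (h i).isoPullback.inv z, ?_⟩
    rw [← Scheme.Hom.comp_apply, (h i).isoPullback_inv_fst, hz]
  · rw [eq_top_iff]
    rintro b -
    obtain ⟨a, rfl⟩ := hπ i b
    refine Subring.closure_le (t := (Algebra.adjoin K
      (Set.range fun m ↦ π i (stdCoord K n i m))).toSubring.comap (π i).hom) |>.mpr ?_
      (stdRing_mem_closure i a)
    rintro _ (⟨r, rfl⟩ | ⟨m, rfl⟩)
    · exact Subalgebra.algebraMap_mem (Algebra.adjoin K _) r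
    · exact Algebra.subset_adjoin ⟨m, rfl⟩
  · exact (congrArg (π i) (awayRatio_self (hx i))).trans (map_one (π i).hom)
  · obtain ⟨ψ, hψ⟩ := exists_comp_awayι_eq (hx i) (hx i') (π i ≫ φ) hφ
    let l := (h i').lift (Spec.map φ ≫ c i) (Spec.map ψ) (by
      rw [Category.assoc, hcomp]
      exact hψ.symm)
    refine ⟨Spec.preimage l, ?_⟩
    rw [Spec.map_preimage]
    exact (h i').lift_fst ..
  · refine map_awayRatio_eq_mul (hx i) (hx i') (π i ≫ φ) (π i' ≫ φ') ?_ (hx m)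
    have := congrArg (· ≫ j) hφ
    simpa only [Category.assoc, hcomp] using this

end ProjectiveSpace

theorem IsProjective.nonempty_projAtlas {K : Type u} [Field K] {X : Scheme.{u}}
    {p : X ⟶ Spec (CommRingCat.of K)} (hp : IsProjective p) : Nonempty (ProjAtlas p) := by
  obtain ⟨n, j, hj, rfl⟩ := hp
  exact @nonempty_projAtlas_of_isClosedImmersion K _ X n j hj (projSpaceToSpec K n)
    (stdChart_comp_projSpaceToSpec K n)

/-! ### Charts of an unramified map -/

section AffineChart

variable {K : Type*} [Field K] {ι : Type*}

theorem pair_mem_of_mem_closure {B : Type*} [CommRing B] [Algebra K B] {g : ι → B} {S : Set K}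
    {b : B} (hb : b ∈ Subring.closure (algebraMap K B '' S ∪ Set.range g))
    {L W : Type*} [Field L] [CommRing W] [IsLocalRing W] [Algebra W L] [Algebra K L]
    (hS : ∀ s ∈ S, algebraMap K L s ∈ (algebraMap W L).range) (φ φ' : B →ₐ[K] L) {k : ℕ}
    (hg : ∀ m, (φ (g m), φ' (g m)) ∈ congrSubring W L k) :
    (φ b, φ' b) ∈ congrSubring W L k := by
  refine map_mem_of_mem_closure hb (φ.toRingHom.prod φ'.toRingHom) (congrSubring W L k) ?_ ?_
  · intro s hs
    have : (φ.toRingHom.prod φ'.toRingHom) (algebraMap K B s) =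
        (algebraMap K L s, algebraMap K L s) := Prod.ext (φ.commutes s) (φ'.commutes s)
    rw [this]
    exact diag_mem_congrSubring (hS s hs)
  · rintro _ ⟨m, rfl⟩
    exact hg m

/-- If `h` is invertible at a `W`-integral point, an unramified map from `D(h)` to `Spec A` induces
an equivalence between congruence modulo the `k`-th power of the maximal ideal of `W` upstairs and
downstairs, on the residue class of this point. -/
theorem exists_finset_congr_iff_congr [Finite ι] {A B : Type*} [CommRing A] [CommRing B]
    [Algebra K A] [Algebra K B] {t : ι → B} (ht : Algebra.adjoin K (Set.range t) = ⊤)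
    {a : ι → A} (ha : Algebra.adjoin K (Set.range a) = ⊤) (h : B)
    (ψ : A →ₐ[K] Localization.Away h) (hψ : ψ.toRingHom.FormallyUnramified) :
    ∃ S : Finset K, ∀ (L W : Type u) [Field L] [CommRing W] [IsLocalRing W] [Algebra W L]
      [FaithfulSMul W L] [Algebra K L],
      (∀ s ∈ S, algebraMap K L s ∈ (algebraMap W L).range) → ∀ (φ φ' : B →ₐ[K] L),
      (∀ m, (φ (t m), φ' (t m)) ∈ congrSubring W L 1) → φ h ≠ 0 →
      (φ h)⁻¹ ∈ (algebraMap W L).range →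
      ∃ χ χ' : Localization.Away h →ₐ[K] L,
        χ.comp (IsScalarTower.toAlgHom K B _) = φ ∧ χ'.comp (IsScalarTower.toAlgHom K B _) = φ' ∧
        ∀ k, 1 ≤ k → ((∀ m, (φ (t m), φ' (t m)) ∈ congrSubring W L k) ↔
          ∀ m, (χ (ψ (a m)), χ' (ψ (a m))) ∈ congrSubring W L k) := by
  classical
  let C := Localization.Away h
  let _ : Algebra A C := ψ.toRingHom.toAlgebra
  have : IsScalarTower K A C := .of_algebraMap_eq fun r ↦ (ψ.commutes r).symm
  have : Algebra.FormallyUnramified A C := hψ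
  let g : Option ι → C := fun o ↦
    o.elim (IsLocalization.Away.invSelf h) fun m ↦ algebraMap B C (t m)
  have hinv : algebraMap B C h * IsLocalization.Away.invSelf h = 1 :=
    IsLocalization.Away.mul_invSelf h
  have hg : Algebra.adjoin K (Set.range g) = ⊤ := by
    have hB : (IsScalarTower.toAlgHom K B C).range ≤ Algebra.adjoin K (Set.range g) := by
      rw [← Algebra.map_top, ← ht, AlgHom.map_adjoin]
      refine Algebra.adjoin_mono ?_
      rintro _ ⟨_, ⟨m, rfl⟩, rfl⟩
      exact ⟨some m, rfl⟩
    refine top_unique fun z _ ↦ ?_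
    obtain ⟨N, b, hb⟩ := IsLocalization.Away.surj h z
    have : z = algebraMap B C b * IsLocalization.Away.invSelf h ^ N := by
      rw [← hb, mul_assoc, ← mul_pow, hinv, one_pow, mul_one]
    rw [this]
    exact mul_mem (hB ⟨b, rfl⟩) (pow_mem (Algebra.subset_adjoin (Set.mem_range_self none)) N)
  obtain ⟨S₁, hS₁⟩ := exists_finset_mem_closure ht h
  obtain ⟨S₂, hS₂⟩ := exists_finset_forall_mem_closure hg fun m ↦ ψ (a m)
  obtain ⟨S₃, hS₃⟩ := exists_finset_congr_of_unramified.{u} (C := C) ha hg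
  refine ⟨S₁ ∪ S₂ ∪ S₃, ?_⟩
  intro L W _ _ _ _ _ _ hS φ φ' h1 hh hhinv
  simp only [Finset.mem_union] at hS
  have hkey : ∀ k, 1 ≤ k → (∀ m, (φ (t m), φ' (t m)) ∈ congrSubring W L k) →
      φ' h ≠ 0 ∧ ((φ h)⁻¹, (φ' h)⁻¹) ∈ congrSubring W L k := fun k hk hm ↦
    inv_mem_congrSubring hk (pair_mem_of_mem_closure hS₁
      (fun s hs ↦ hS s (.inl (.inl hs))) φ φ' hm) hh hhinv
  have hh' : φ' h ≠ 0 := (hkey 1 le_rfl h1).1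
  have ext : ∀ θ : B →ₐ[K] L, θ h ≠ 0 → ∃ χ : C →ₐ[K] L,
      χ.comp (IsScalarTower.toAlgHom K B C) = θ := fun θ hθ ↦ by
    have hu : IsUnit (θ.toRingHom h) := Ne.isUnit hθ
    let χ : C →+* L := IsLocalization.Away.lift h hu
    have hχ : ∀ b, χ (algebraMap B C b) = θ b := IsLocalization.Away.lift_eq h hu
    refine ⟨{ χ with commutes' := fun r ↦ ?_ }, AlgHom.ext hχ⟩
    exact (congrArg χ (IsScalarTower.algebraMap_apply K B C r)).trans
      ((hχ _).trans (θ.commutes r))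
  obtain ⟨χ, hχ⟩ := ext φ hh
  obtain ⟨χ', hχ'⟩ := ext φ' hh'
  have hχt : ∀ b, χ (algebraMap B C b) = φ b := fun b ↦ congr($hχ b)
  have hχt' : ∀ b, χ' (algebraMap B C b) = φ' b := fun b ↦ congr($hχ' b)
  have hi : χ (IsLocalization.Away.invSelf h) = (φ h)⁻¹ :=
    eq_inv_of_mul_eq_one_right (by rw [← hχt, ← map_mul, hinv, map_one])
  have hi' : χ' (IsLocalization.Away.invSelf h) = (φ' h)⁻¹ :=
    eq_inv_of_mul_eq_one_right (by rw [← hχt', ← map_mul, hinv, map_one])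
  have hgk : ∀ k, 1 ≤ k → (∀ m, (φ (t m), φ' (t m)) ∈ congrSubring W L k) →
      ∀ o, (χ (g o), χ' (g o)) ∈ congrSubring W L k := by
    rintro k hk hm (_ | m)
    · change (χ (IsLocalization.Away.invSelf h), χ' (IsLocalization.Away.invSelf h)) ∈ _
      rw [hi, hi']
      exact (hkey k hk hm).2
    · change (χ (algebraMap B C (t m)), χ' (algebraMap B C (t m))) ∈ _
      rw [hχt, hχt']
      exact hm m
  refine ⟨χ, χ', hχ, hχ', fun k hk ↦ ⟨fun hm m ↦ ?_, fun hm m ↦ ?_⟩⟩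
  · exact pair_mem_of_mem_closure (hS₂ m) (fun s hs ↦ hS s (.inl (.inr hs))) χ χ' (hgk k hk hm)
  · have := hS₃ L W (fun s hs ↦ hS s (.inr hs)) χ χ' (hgk 1 le_rfl h1) k hm (some m)
    change (χ (algebraMap B C (t m)), χ' (algebraMap B C (t m))) ∈ _ at this
    rwa [hχt, hχt'] at this

/-- If the elements of `H` generate the unit ideal of `B`, then at each `W`-integral point of
`Spec B` some element of `H` takes a unit of `W` as value. -/
theorem exists_finset_exists_inv_mem {B : Type*} [CommRing B] [Algebra K B] {t : ι → B}
    (ht : Algebra.adjoin K (Set.range t) = ⊤) (H : Finset B)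
    (hH : Ideal.span (H : Set B) = ⊤) :
    ∃ S : Finset K, ∀ (L W : Type u) [Field L] [CommRing W] [IsLocalRing W] [Algebra W L]
      [FaithfulSMul W L] [Algebra K L],
      (∀ s ∈ S, algebraMap K L s ∈ (algebraMap W L).range) → ∀ φ : B →ₐ[K] L,
      (∀ m, φ (t m) ∈ (algebraMap W L).range) →
      ∃ h ∈ H, φ h ≠ 0 ∧ (φ h)⁻¹ ∈ (algebraMap W L).range := by
  classical
  obtain ⟨c, hc⟩ : ∃ c : B → B, ∑ h ∈ H, c h * h = 1 := by
    obtain ⟨c, -, hc⟩ := Submodule.mem_span_finset.mp ((Ideal.eq_top_iff_one _).mp hH)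
    exact ⟨c, by simpa using hc⟩
  obtain ⟨S₁, hS₁⟩ := exists_finset_forall_mem_closure ht (fun h : H ↦ c h)
  obtain ⟨S₂, hS₂⟩ := exists_finset_forall_mem_closure ht (fun h : H ↦ (h : B))
  refine ⟨S₁ ∪ S₂, ?_⟩
  intro L W _ _ _ _ _ _ hS φ hφ
  simp only [Finset.mem_union] at hS
  have inj := FaithfulSMul.algebraMap_injective W L
  have hint : ∀ {b : B} {S : Finset K}, (∀ s ∈ S, algebraMap K L s ∈ (algebraMap W L).range) →
      b ∈ Subring.closure (algebraMap K B '' S ∪ Set.range t) → φ b ∈ (algebraMap W L).range :=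
    fun hS hb ↦ fst_mem_range_of_mem_congrSubring (pair_mem_of_mem_closure (k := 1) hb hS φ φ
      fun m ↦ diag_mem_congrSubring (hφ m))
  have h₁ : ∀ h : H, ∃ w, algebraMap W L w = φ (c h) :=
    fun h ↦ hint (fun s hs ↦ hS s (.inl hs)) (hS₁ h)
  have h₂ : ∀ h : H, ∃ w, algebraMap W L w = φ h :=
    fun h ↦ hint (fun s hs ↦ hS s (.inr hs)) (hS₂ h)
  choose u hu using h₁
  choose v hv using h₂
  have hsum : ∑ h : H, u h * v h = 1 := by
    apply inj
    rw [map_sum, map_one, ← map_one φ, ← hc, map_sum, ← Finset.sum_coe_sort H]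
    simp only [map_mul, hu, hv]
  obtain ⟨h, hh⟩ : ∃ h : H, IsUnit (v h) := by
    by_contra! hall
    have : (1 : W) ∈ IsLocalRing.maximalIdeal W := by
      rw [← hsum]
      exact sum_mem fun h _ ↦ Ideal.mul_mem_left _ _ ((IsLocalRing.mem_maximalIdeal _).mpr (hall h))
    exact (IsLocalRing.mem_maximalIdeal _).mp this isUnit_one
  obtain ⟨w, hw⟩ := hh.exists_right_inv
  have hw' : φ h * algebraMap W L w = 1 := by rw [← hv, ← map_mul, hw, map_one]
  exact ⟨h, h.2, left_ne_zero_of_mul_eq_one hw', w, eq_inv_of_mul_eq_one_right hw'⟩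

/-- Every function on an affine chart becomes `W`-integral after multiplication by a suitable
nonzero constant. -/
theorem exists_ne_zero_mul_pair_mem {B : Type*} [CommRing B] [Algebra K B] {t : ι → B}
    (ht : Algebra.adjoin K (Set.range t) = ⊤) {L : Type*} (W : Type*) [Field L] [CommRing W]
    [IsDomain W] [IsLocalRing W] [Algebra W L] [IsFractionRing W L] [Algebra K L] (b : B) :
    ∃ c : W, c ≠ 0 ∧ ∀ (φ φ' : B →ₐ[K] L) (k : ℕ),
      (∀ m, (φ (t m), φ' (t m)) ∈ congrSubring W L k) →
      (algebraMap W L c * φ b, algebraMap W L c * φ' b) ∈ congrSubring W L k := by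
  have hb : b ∈ Algebra.adjoin K (Set.range t) := ht ▸ Algebra.mem_top
  have hdiag : ∀ (c : W) (k : ℕ),
      (algebraMap W L c, algebraMap W L c) ∈ congrSubring W L k :=
    fun c k ↦ diag_mem_congrSubring ⟨c, rfl⟩
  induction hb using Algebra.adjoin_induction with
  | mem x hx =>
    obtain ⟨m, rfl⟩ := hx
    exact ⟨1, one_ne_zero, fun φ φ' k h ↦ by simpa using h m⟩
  | algebraMap r =>
    obtain ⟨a, c, hc, hr⟩ := IsFractionRing.div_surjective (A := W) (algebraMap K L r)
    have hc0 : algebraMap W L c ≠ 0 := by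
      simpa using nonZeroDivisors.ne_zero hc
    refine ⟨c, nonZeroDivisors.ne_zero hc, fun φ φ' k _ ↦ ?_⟩
    rw [φ.commutes, φ'.commutes, ← hr, mul_div_cancel₀ _ hc0]
    exact hdiag a k
  | add x y _ _ hx hy =>
    obtain ⟨c, hc, hx⟩ := hx
    obtain ⟨c', hc', hy⟩ := hy
    refine ⟨c * c', mul_ne_zero hc hc', fun φ φ' k h ↦ ?_⟩
    convert add_mem (mul_mem (hdiag c' k) (hx φ φ' k h)) (mul_mem (hdiag c k) (hy φ φ' k h))
      using 1
    ext <;> simp <;> ring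
  | mul x y _ _ hx hy =>
    obtain ⟨c, hc, hx⟩ := hx
    obtain ⟨c', hc', hy⟩ := hy
    refine ⟨c * c', mul_ne_zero hc hc', fun φ φ' k h ↦ ?_⟩
    convert mul_mem (hx φ φ' k h) (hy φ φ' k h) using 1
    ext <;> simp <;> ring

end AffineChart

/-! ### Congruences between points of a projective scheme -/

namespace ProjAtlas

variable {K : Type u} [Field K] {X : Scheme.{u}} {p : X ⟶ Spec (CommRingCat.of K)}
  (𝔄 : ProjAtlas p) {L : Type u} [Field L]

section

variable {W : Type u} [CommRing W] [IsLocalRing W] [Algebra W L]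

variable (W) in
/-- Two `L`-points that are integral in the chart `i` and congruent there modulo the `k`-th power
of the maximal ideal of `W`. -/
def CongrIn (i : Fin (𝔄.n + 1)) (k : ℕ) (x y : Spec (.of L) ⟶ X) : Prop :=
  ∃ φ φ' : 𝔄.B i ⟶ .of L, Spec.map φ ≫ 𝔄.c i = x ∧ Spec.map φ' ≫ 𝔄.c i = y ∧
    ∀ m, (φ (𝔄.t i m), φ' (𝔄.t i m)) ∈ congrSubring W L k

variable {𝔄}

theorem hom_eq_of_comp_eq {i : Fin (𝔄.n + 1)} {φ φ' : 𝔄.B i ⟶ .of L}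
    (h : Spec.map φ ≫ 𝔄.c i = Spec.map φ' ≫ 𝔄.c i) : φ = φ' :=
  Spec.map_injective ((cancel_mono _).mp h)

theorem exists_comp_eq_of_mem_range {i : Fin (𝔄.n + 1)} (x : Spec (.of L) ⟶ X)
    {z : Spec (CommRingCat.of L)} (h : x z ∈ Set.range (𝔄.c i)) :
    ∃ φ : 𝔄.B i ⟶ .of L, Spec.map φ ≫ 𝔄.c i = x := by
  have hr : Set.range x ⊆ Set.range (𝔄.c i) := by
    rintro _ ⟨z', rfl⟩
    rwa [Subsingleton.elim z' z]
  refine ⟨Spec.preimage (IsOpenImmersion.lift (𝔄.c i) x hr), ?_⟩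
  rw [Spec.map_preimage, IsOpenImmersion.lift_fac]

theorem comp_algebraMap_eq [Algebra K L] {i : Fin (𝔄.n + 1)} {φ : 𝔄.B i ⟶ .of L}
    (h : Spec.map φ ≫ 𝔄.c i ≫ p = Spec.map (CommRingCat.ofHom (algebraMap K L))) (r : K) :
    φ (algebraMap K (𝔄.B i) r) = algebraMap K L r := by
  rw [𝔄.c_comp, ← Spec.map_comp] at h
  exact congr($(Spec.map_injective h) r)

/-- Congruence of two points can be tested in every chart in which the first one is integral. -/
theorem CongrIn.change {i j : Fin (𝔄.n + 1)} {k : ℕ} (hk : 1 ≤ k) {x y : Spec (.of L) ⟶ X}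
    [FaithfulSMul W L] (h : 𝔄.CongrIn W i k x y) {φ : 𝔄.B j ⟶ .of L}
    (hφ : Spec.map φ ≫ 𝔄.c j = x) (hint : ∀ m, φ (𝔄.t j m) ∈ (algebraMap W L).range) :
    ∃ φ' : 𝔄.B j ⟶ .of L, Spec.map φ' ≫ 𝔄.c j = y ∧
      ∀ m, (φ (𝔄.t j m), φ' (𝔄.t j m)) ∈ congrSubring W L k := by
  obtain ⟨ψ, ψ', hψ, hψ', hD⟩ := h
  have h₁ := 𝔄.map_t_eq_mul ψ φ (hψ.trans hφ.symm)
  have hone : ψ (𝔄.t i j) * φ (𝔄.t j i) = 1 := by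
    rw [← h₁, 𝔄.t_self]
    exact map_one ψ.hom
  have hinv : (ψ (𝔄.t i j))⁻¹ = φ (𝔄.t j i) := (eq_inv_of_mul_eq_one_right hone).symm
  have h0 : ψ (𝔄.t i j) ≠ 0 := left_ne_zero_of_mul_eq_one hone
  obtain ⟨h0', hD'⟩ := inv_mem_congrSubring hk (hD j) h0 (hinv ▸ hint i)
  obtain ⟨φ', hφ'⟩ := 𝔄.exists_comp_eq ψ' h0'
  refine ⟨φ', hφ'.trans hψ', fun m ↦ ?_⟩
  have h₂ := 𝔄.map_t_eq_mul ψ' φ' hφ'.symm m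
  convert mul_mem hD' (hD m) using 1
  ext
  · simp [h₁ m, h0]
  · simp [h₂, h0']

theorem CongrIn.trans {i j : Fin (𝔄.n + 1)} {k : ℕ} (hk : 1 ≤ k) {x y z : Spec (.of L) ⟶ X}
    [FaithfulSMul W L] (h : 𝔄.CongrIn W i k x y) (h' : 𝔄.CongrIn W j k y z) :
    𝔄.CongrIn W i k x z := by
  obtain ⟨φ, φ', hφ, hφ', hD⟩ := h
  obtain ⟨φ'', hφ'', hD'⟩ :=
    h'.change hk hφ' fun m ↦ snd_mem_range_of_mem_congrSubring (hD m)
  exact ⟨φ, φ'', hφ, hφ'', fun m ↦ congrSubring_trans (hD m) (hD' m)⟩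

end

/-- Every point is integral in some chart: divide its homogeneous coordinates by one of maximal
absolute value. -/
theorem exists_integral_chart (W : Type u) [CommRing W] [IsDomain W] [ValuationRing W]
    [Algebra W L] [IsFractionRing W L] (x : Spec (.of L) ⟶ X) :
    ∃ (j : Fin (𝔄.n + 1)) (φ : 𝔄.B j ⟶ .of L), Spec.map φ ≫ 𝔄.c j = x ∧
      ∀ m, φ (𝔄.t j m) ∈ (algebraMap W L).range := by
  obtain ⟨i, hi⟩ := 𝔄.cover (x (IsLocalRing.closedPoint L))
  obtain ⟨φ, rfl⟩ := exists_comp_eq_of_mem_range x hi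
  let v := ValuationRing.valuation W L
  obtain ⟨j, hj⟩ := Finite.exists_max fun m ↦ v (φ (𝔄.t i m))
  have hii : φ (𝔄.t i i) = 1 := by
    rw [𝔄.t_self]
    exact map_one φ.hom
  have hj0 : φ (𝔄.t i j) ≠ 0 := by
    intro h0
    have := hj i
    rw [h0, hii, map_one, map_zero] at this
    simp at this
  obtain ⟨φ', hφ'⟩ := 𝔄.exists_comp_eq φ hj0
  refine ⟨j, φ', hφ', fun m ↦ ?_⟩
  refine (ValuationRing.mem_integer_iff W L _).mp ?_
  have := hj m
  rw [𝔄.map_t_eq_mul φ φ' hφ'.symm m, map_mul] at this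
  rw [Valuation.mem_integer_iff]
  exact (mul_le_iff_le_one_right (by simpa [zero_lt_iff] using hj0)).mp this

/-- The preimages under `f` of the charts cover each chart by basic open subsets. -/
theorem exists_finset_span_eq_top (f : X ⟶ X) (i : Fin (𝔄.n + 1)) :
    ∃ H : Finset (𝔄.B i), Ideal.span (H : Set (𝔄.B i)) = ⊤ ∧ ∀ h ∈ H, ∃ (j : Fin (𝔄.n + 1))
      (ψ : 𝔄.B j ⟶ .of (Localization.Away h)), Spec.map ψ ≫ 𝔄.c j =
        Spec.map (CommRingCat.ofHom (algebraMap (𝔄.B i) (Localization.Away h))) ≫ 𝔄.c i ≫ f := by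
  let T : Set (𝔄.B i) := {h | ∃ (j : Fin (𝔄.n + 1)) (ψ : 𝔄.B j ⟶ .of (Localization.Away h)),
    Spec.map ψ ≫ 𝔄.c j =
      Spec.map (CommRingCat.ofHom (algebraMap (𝔄.B i) (Localization.Away h))) ≫ 𝔄.c i ≫ f}
  suffices hT : Ideal.span T = ⊤ by
    obtain ⟨H, hH, hH'⟩ := (Ideal.span_eq_top_iff_finite T).mp hT
    exact ⟨H, hH', fun h hh ↦ hH hh⟩
  by_contra hT
  obtain ⟨M, hM, hTM⟩ := Ideal.exists_le_maximal _ hT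
  let z : Spec (𝔄.B i) := ⟨M, hM.isPrime⟩
  obtain ⟨j, hj⟩ := 𝔄.cover ((𝔄.c i ≫ f) z)
  obtain ⟨_, ⟨_, ⟨h, rfl⟩, rfl⟩, hz, hU⟩ :=
    PrimeSpectrum.isBasis_basic_opens.exists_subset_of_mem_open
      (show z ∈ ((𝔄.c i ≫ f) ⁻¹ᵁ (𝔄.c j).opensRange : Set (Spec (𝔄.B i))) from hj)
      ((𝔄.c i ≫ f) ⁻¹ᵁ (𝔄.c j).opensRange).isOpen
  refine hz (hTM (Ideal.subset_span ⟨j, ?_⟩))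
  let g := Spec.map (CommRingCat.ofHom (algebraMap (𝔄.B i) (Localization.Away h))) ≫ 𝔄.c i ≫ f
  have hr : Set.range g ⊆ Set.range (𝔄.c j) := by
    rintro _ ⟨w, rfl⟩
    refine hU ?_
    exact (PrimeSpectrum.localization_away_comap_range (Localization.Away h) h).le ⟨w, rfl⟩
  refine ⟨Spec.preimage (IsOpenImmersion.lift (𝔄.c j) g hr), ?_⟩
  rw [Spec.map_preimage, IsOpenImmersion.lift_fac]

/-- `exists_finset_congr_iff_congr` for the restriction of `f` to a basic open subset `D(h)` of the
chart `i` that is mapped to the chart `j`. -/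
theorem exists_finset_basicOpen (f : X ⟶ X) (hf : f ≫ p = p) [FormallyUnramified f]
    {i j : Fin (𝔄.n + 1)} (h : 𝔄.B i) (ψ : 𝔄.B j ⟶ .of (Localization.Away h))
    (hψ : Spec.map ψ ≫ 𝔄.c j =
      Spec.map (CommRingCat.ofHom (algebraMap (𝔄.B i) (Localization.Away h))) ≫ 𝔄.c i ≫ f) :
    ∃ S : Finset K, ∀ (L W : Type u) [Field L] [CommRing W] [IsLocalRing W] [Algebra W L]
      [FaithfulSMul W L] [Algebra K L],
      (∀ s ∈ S, algebraMap K L s ∈ (algebraMap W L).range) → ∀ (φ φ' : 𝔄.B i ⟶ .of L),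
      Spec.map φ ≫ 𝔄.c i ≫ p = Spec.map (CommRingCat.ofHom (algebraMap K L)) →
      Spec.map φ' ≫ 𝔄.c i ≫ p = Spec.map (CommRingCat.ofHom (algebraMap K L)) →
      (∀ m, (φ (𝔄.t i m), φ' (𝔄.t i m)) ∈ congrSubring W L 1) →
      φ h ≠ 0 → (φ h)⁻¹ ∈ (algebraMap W L).range →
      ∃ θ θ' : 𝔄.B j ⟶ .of L, Spec.map θ ≫ 𝔄.c j = Spec.map φ ≫ 𝔄.c i ≫ f ∧
        Spec.map θ' ≫ 𝔄.c j = Spec.map φ' ≫ 𝔄.c i ≫ f ∧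
        ∀ k, 1 ≤ k → ((∀ m, (φ (𝔄.t i m), φ' (𝔄.t i m)) ∈ congrSubring W L k) ↔
          ∀ m, (θ (𝔄.t j m), θ' (𝔄.t j m)) ∈ congrSubring W L k) := by
  have hK : CommRingCat.ofHom (algebraMap K (𝔄.B j)) ≫ ψ =
      CommRingCat.ofHom (algebraMap K (𝔄.B i)) ≫
        CommRingCat.ofHom (algebraMap (𝔄.B i) (Localization.Away h)) := by
    apply Spec.map_injective
    rw [Spec.map_comp, Spec.map_comp, ← 𝔄.c_comp, ← 𝔄.c_comp, ← Category.assoc, hψ,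
      Category.assoc, Category.assoc, hf]
  let ψ' : 𝔄.B j →ₐ[K] Localization.Away h :=
    { ψ.hom with
      commutes' := fun r ↦ congr($hK r).trans (IsScalarTower.algebraMap_apply K _ _ r).symm }
  have hunr : FormallyUnramified (Spec.map ψ) := by
    have : FormallyUnramified (Spec.map ψ ≫ 𝔄.c j) := by
      rw [hψ]
      exact MorphismProperty.comp_mem @FormallyUnramified _ _ inferInstance
        (MorphismProperty.comp_mem @FormallyUnramified _ _ inferInstance inferInstance)
    exact FormallyUnramified.of_comp _ (𝔄.c j)
  have hunr' : ψ'.toRingHom.FormallyUnramified :=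
    (HasRingHomProperty.Spec_iff (P := @FormallyUnramified)).mp hunr
  obtain ⟨S, hS⟩ := exists_finset_congr_iff_congr.{u} (𝔄.adjoin_range_t i) (𝔄.adjoin_range_t j)
    h ψ' hunr'
  refine ⟨S, ?_⟩
  intro L W _ _ _ _ _ _ hSW φ φ' hφ hφ' h1 hh hhinv
  obtain ⟨χ, χ', hχ, hχ', hiff⟩ := hS L W hSW
    { φ.hom with commutes' := comp_algebraMap_eq hφ }
    { φ'.hom with commutes' := comp_algebraMap_eq hφ' } h1 hh hhinv
  have hcomp : ∀ (χ : Localization.Away h →ₐ[K] L) (φ : 𝔄.B i ⟶ .of L),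
      (∀ b, χ (algebraMap (𝔄.B i) (Localization.Away h) b) = φ b) →
      Spec.map (ψ ≫ CommRingCat.ofHom χ.toRingHom) ≫ 𝔄.c j = Spec.map φ ≫ 𝔄.c i ≫ f :=
    fun χ φ hb ↦ by
      rw [Spec.map_comp, Category.assoc, hψ, ← Category.assoc, ← Spec.map_comp]
      congr 2
      ext b
      exact hb b
  exact ⟨ψ ≫ CommRingCat.ofHom χ.toRingHom, ψ ≫ CommRingCat.ofHom χ'.toRingHom,
    hcomp χ φ fun b ↦ congr($hχ b), hcomp χ' φ' fun b ↦ congr($hχ' b), hiff⟩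

/-- An unramified endomorphism `f` has good reduction at the local rings that contain a suitable
finite set of elements of `K`: points congruent modulo the maximal ideal have images congruent
modulo the maximal ideal, and then congruence modulo its `k`-th power for the points is equivalent
to the one for the images. -/
theorem exists_finset_good_reduction (f : X ⟶ X) (hf : f ≫ p = p) [FormallyUnramified f] :
    ∃ S : Finset K, ∀ (L W : Type u) [Field L] [CommRing W] [IsLocalRing W] [Algebra W L]
      [FaithfulSMul W L] [Algebra K L],
      (∀ s ∈ S, algebraMap K L s ∈ (algebraMap W L).range) → ∀ i (φ φ' : 𝔄.B i ⟶ .of L),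
      Spec.map φ ≫ 𝔄.c i ≫ p = Spec.map (CommRingCat.ofHom (algebraMap K L)) →
      Spec.map φ' ≫ 𝔄.c i ≫ p = Spec.map (CommRingCat.ofHom (algebraMap K L)) →
      (∀ m, (φ (𝔄.t i m), φ' (𝔄.t i m)) ∈ congrSubring W L 1) →
      ∃ j, ∃ θ θ' : 𝔄.B j ⟶ .of L, Spec.map θ ≫ 𝔄.c j = Spec.map φ ≫ 𝔄.c i ≫ f ∧
        Spec.map θ' ≫ 𝔄.c j = Spec.map φ' ≫ 𝔄.c i ≫ f ∧
        ∀ k, 1 ≤ k → ((∀ m, (φ (𝔄.t i m), φ' (𝔄.t i m)) ∈ congrSubring W L k) ↔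
          ∀ m, (θ (𝔄.t j m), θ' (𝔄.t j m)) ∈ congrSubring W L k) := by
  classical
  choose H hH hpiece using fun i ↦ exists_finset_span_eq_top (𝔄 := 𝔄) f i
  choose S₁ hS₁ using fun i ↦
    exists_finset_exists_inv_mem.{u} (𝔄.adjoin_range_t i) (H i) (hH i)
  choose j ψ hψ using fun i (h : H i) ↦ hpiece i h h.2
  choose S₂ hS₂ using fun i (h : H i) ↦ 𝔄.exists_finset_basicOpen f hf (h : 𝔄.B i) (ψ i h) (hψ i h)
  refine ⟨Finset.univ.biUnion fun i ↦ S₁ i ∪ Finset.univ.biUnion (S₂ i), ?_⟩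
  intro L W _ _ _ _ _ _ hS i φ φ' hφ hφ' h1
  simp only [Finset.mem_biUnion, Finset.mem_univ, true_and, Finset.mem_union] at hS
  obtain ⟨h, hh, hh0, hhinv⟩ := hS₁ i L W (fun s hs ↦ hS s ⟨i, .inl hs⟩)
    { φ.hom with commutes' := comp_algebraMap_eq hφ }
    (fun m ↦ fst_mem_range_of_mem_congrSubring (h1 m))
  exact ⟨j i ⟨h, hh⟩, hS₂ i ⟨h, hh⟩ L W (fun s hs ↦ hS s ⟨i, .inr ⟨⟨h, hh⟩, hs⟩⟩) φ φ' hφ hφ' h1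
    hh0 hhinv⟩

/-- A point that is congruent to points of a closed subscheme `Y` modulo all powers of the maximal
ideal lies in `Y`. -/
theorem exists_comp_eq_of_forall_congrIn {W : Type u} [CommRing W] [IsDomain W]
    [IsDiscreteValuationRing W] [Algebra W L] [IsFractionRing W L] [Algebra K L]
    {Y : Scheme.{u}} (ι : Y ⟶ X) [IsClosedImmersion ι] (x : Spec (.of L) ⟶ X)
    (hx : x ≫ p = Spec.map (CommRingCat.ofHom (algebraMap K L)))
    (h : ∀ k, 1 ≤ k → ∃ y : Spec (.of L) ⟶ Y,
      (y ≫ ι) ≫ p = Spec.map (CommRingCat.ofHom (algebraMap K L)) ∧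
        ∃ i, 𝔄.CongrIn W i k x (y ≫ ι)) :
    ∃ y : Spec (.of L) ⟶ Y, y ≫ ι = x := by
  have : FaithfulSMul W L := inferInstance
  obtain ⟨j, φ, rfl, hint⟩ := exists_integral_chart (𝔄 := 𝔄) W x
  obtain ⟨B, c, π, hπ, hsq⟩ := exists_isPullback_Spec ι (𝔄.c j)
  have hker : ∀ g, π g = 0 → φ g = 0 := by
    intro g hg
    obtain ⟨w, hw, hwk⟩ := exists_ne_zero_mul_pair_mem (𝔄.adjoin_range_t j) (L := L) W g
    have hw' : algebraMap W L w ≠ 0 := by simpa using hw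
    suffices algebraMap W L w * φ g = 0 from (mul_eq_zero.mp this).resolve_left hw'
    refine eq_zero_of_forall_mem_congrSubring (W := W) fun k hk ↦ ?_
    obtain ⟨y, hy, i, hyi⟩ := h k hk
    obtain ⟨ψ, hψ, hD⟩ := hyi.change hk rfl hint
    have hψ0 : ψ g = 0 := by
      let χ := Spec.preimage (hsq.lift y (Spec.map ψ) hψ.symm)
      have : ψ = π ≫ χ := Spec.map_injective (by
        rw [Spec.map_comp, Spec.map_preimage, hsq.lift_snd])
      rw [this]
      simp [hg]
    have hwD : (algebraMap W L w * φ g, algebraMap W L w * ψ g) ∈ congrSubring W L k :=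
      hwk { φ.hom with commutes' := comp_algebraMap_eq (by rwa [Category.assoc] at hx) }
        { ψ.hom with commutes' := comp_algebraMap_eq (by rwa [← hψ, Category.assoc] at hy) } k hD
    rwa [hψ0, mul_zero] at hwD
  let χ : B →+* L := RingHom.liftOfSurjective π.hom hπ ⟨φ.hom, hker⟩
  have hχ : φ = π ≫ CommRingCat.ofHom χ := by
    ext g
    exact (π.hom.liftOfRightInverse_comp_apply (Function.surjInv hπ)
      (Function.rightInverse_surjInv hπ) ⟨φ.hom, hker⟩ g).symm
  refine ⟨Spec.map (CommRingCat.ofHom χ) ≫ c, ?_⟩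
  rw [hχ, Category.assoc, hsq.w, Spec.map_comp, Category.assoc]

end ProjAtlas

/-! ### Iterated preimages of an invariant subscheme -/

section

variable {K : Type u} [Field K] {X : Scheme.{u}} {p : X ⟶ Spec (CommRingCat.of K)}

/-- The action of a `K`-endomorphism on `L`-points. -/
noncomputable def Points.map (f : X ⟶ X) (hf : f ≫ p = p) {L : Type u} [Field L] [Algebra K L]
    (x : Points p L) : Points p L :=
  ⟨x.1 ≫ f, by rw [Category.assoc, hf, x.2]⟩

theorem Points.iterate_map (f : X ⟶ X) (hf : f ≫ p = p) {L : Type u} [Field L] [Algebra K L]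
    (x : Points p L) (n : ℕ) : ((Points.map f hf)^[n] x).1 = x.1 ≫ iter f n := by
  induction n with
  | zero => exact (Category.comp_id _).symm
  | succ n ih =>
    rw [Function.iterate_succ_apply']
    change ((Points.map f hf)^[n] x).1 ≫ f = _
    rw [ih, Category.assoc]
    rfl

theorem isEmpty_points_preimageDiff {Y : Scheme.{u}} (f : X ⟶ X) (i : Y ⟶ X)
    [IsClosedImmersion i] {s : ℕ} {L : Type u} [Field L] [Algebra K L]
    (h : ∀ x : Points p L, (∃ y, y ≫ i = x.1 ≫ iter f (s + 1)) → ∃ y, y ≫ i = x.1 ≫ iter f s) :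
    IsEmpty (Points (preimageDiffι f i s ≫ p) L) := by
  refine ⟨fun ⟨x, hx⟩ ↦ ?_⟩
  let U := preimageι f i (s + 1) ⁻¹ᵁ preimageCompl f i s
  obtain ⟨y, hy⟩ := h ⟨x ≫ preimageDiffι f i s, by rwa [Category.assoc]⟩
    ⟨x ≫ U.ι ≫ pullback.snd _ _, by
      simp only [preimageDiffι, Category.assoc, pullback.condition, U]⟩
  let l := pullback.lift (x ≫ preimageDiffι f i s) y hy.symm
  let z : Spec (CommRingCat.of L) := IsLocalRing.closedPoint L
  have hmem : preimageι f i (s + 1) (U.ι (x z)) ∈ preimageCompl f i s := (x z).2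
  have hl : l ≫ preimageι f i s = x ≫ preimageDiffι f i s := pullback.lift_fst _ _ _
  exact hmem ⟨l z, congr($hl z)⟩

end

/-- The statement for an unramified endomorphism: the congruences modulo powers of the maximal ideal
of a place of good reduction satisfy the hypotheses of `iterate_mem_of_iterate_succ_mem`. -/
theorem exists_forall_isEmpty_points_preimageDiff (K : Type u) [Field K] [NumberField K]
    {X : Scheme.{u}} {p : X ⟶ Spec (CommRingCat.of K)} (hX : IsProjective p)
    (f : X ⟶ X) (hf : f ≫ p = p) [FormallyUnramified f]
    {Y : Scheme.{u}} (i : Y ⟶ X) [IsClosedImmersion i] (hY : IsInvariant f i) (d : ℕ) :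
    ∃ s₀ : ℕ, ∀ (L : Type u) [Field L] [Algebra K L] [FiniteDimensional K L],
      Module.finrank K L ≤ d → ∀ s : ℕ, s₀ ≤ s →
        IsEmpty (Points (preimageDiffι f i s ≫ p) L) := by
  obtain ⟨𝔄⟩ := hX.nonempty_projAtlas
  obtain ⟨S, hS⟩ := 𝔄.exists_finset_good_reduction f hf
  obtain ⟨Q, hQ⟩ := exists_localRing_of_finset K d S
  -- a bound for the number of pairs of a chart and a vector of coordinates in a residue field
  refine ⟨(𝔄.n + 1) * Q ^ (𝔄.n + 1), ?_⟩
  intro L _ _ _ hL s hs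
  obtain ⟨W, _, _, _, _, _, hfin, hcard, hSW⟩ := hQ L hL
  have : FaithfulSMul W L := inferInstance
  refine isEmpty_points_preimageDiff f i fun x hx ↦ ?_
  obtain ⟨g, hg⟩ := hY
  let m := IsLocalRing.maximalIdeal W
  have hfin' : ∀ k, Finite (W ⧸ m ^ k) := fun k ↦
    Ideal.finite_quotient_pow (IsNoetherian.noetherian m) k
  -- reduction modulo `m ^ k`: a chart in which `x` is integral, and its coordinates there
  have hint : ∀ x : Points p L, ∃ c : Fin (𝔄.n + 1) × (Fin (𝔄.n + 1) → W),
      ∃ φ : 𝔄.B c.1 ⟶ .of L, Spec.map φ ≫ 𝔄.c c.1 = x.1 ∧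
        ∀ a, algebraMap W L (c.2 a) = φ (𝔄.t c.1 a) := fun x ↦ by
    obtain ⟨j, φ, hφ, h⟩ := ProjAtlas.exists_integral_chart (𝔄 := 𝔄) W x.1
    choose w hw using h
    exact ⟨(j, w), φ, hφ, hw⟩
  choose γ hγ using hint
  -- good reduction of `f`, at two points congruent modulo `m`
  have hstep : ∀ x y : Points p L, ∀ j, 𝔄.CongrIn W j 1 x.1 y.1 → ∃ j', ∃ θ θ' : 𝔄.B j' ⟶ .of L,
      Spec.map θ ≫ 𝔄.c j' = x.1 ≫ f ∧ Spec.map θ' ≫ 𝔄.c j' = y.1 ≫ f ∧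
      (∀ a, (θ (𝔄.t j' a), θ' (𝔄.t j' a)) ∈ congrSubring W L 1) ∧
      ∀ k, 1 ≤ k → (∀ a, (θ (𝔄.t j' a), θ' (𝔄.t j' a)) ∈ congrSubring W L k) →
        𝔄.CongrIn W j k x.1 y.1 := by
    rintro ⟨x, hx⟩ ⟨y, hy⟩ j ⟨φ, φ', rfl, rfl, hD⟩
    obtain ⟨j', θ, θ', hθ, hθ', hiff⟩ := hS L W hSW j φ φ' (by rwa [Category.assoc] at hx)
      (by rwa [Category.assoc] at hy) hD
    exact ⟨j', θ, θ', by rw [hθ, Category.assoc], by rw [hθ', Category.assoc],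
      (hiff 1 le_rfl).mp hD, fun k hk h ↦ ⟨φ, φ', rfl, rfl, (hiff k hk).mpr h⟩⟩
  have hmain := iterate_mem_of_iterate_succ_mem (Points.map f hf)
    {x : Points p L | ∃ y, y ≫ i = x.1}
    (by
      rintro ⟨_, _⟩ ⟨y, rfl⟩
      exact ⟨y ≫ g, by rw [Category.assoc, hg]; exact (Category.assoc _ _ _).symm⟩)
    (fun k x y ↦ ∃ j, 𝔄.CongrIn W j k x.1 y.1)
    (fun x y z ⟨j, h⟩ ⟨j', h'⟩ ↦ ⟨j, h.trans le_rfl h'⟩)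
    (fun x y ⟨j, h⟩ ↦ by
      obtain ⟨j', θ, θ', hθ, hθ', hD, -⟩ := hstep x y j h
      exact ⟨j', θ, θ', hθ, hθ', hD⟩)
    (by
      rintro k hk x y ⟨j, h⟩ ⟨j₁, h₁⟩
      obtain ⟨j', θ, θ', hθ, hθ', hD, hlift⟩ := hstep x y j h
      obtain ⟨θ'', hθ'', hD'⟩ := h₁.change hk hθ
        fun a ↦ fst_mem_range_of_mem_congrSubring (hD a)
      obtain rfl : θ' = θ'' := ProjAtlas.hom_eq_of_comp_eq (hθ'.trans hθ''.symm)
      exact ⟨j, hlift k hk hD'⟩)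
    (fun k ↦ Fin (𝔄.n + 1) × (Fin (𝔄.n + 1) → W ⧸ m ^ k))
    (fun k x ↦ ((γ x).1, fun a ↦ Ideal.Quotient.mk _ ((γ x).2 a)))
    (by
      intro k hk x y h
      obtain ⟨φ, hφ, hw⟩ := hγ x
      obtain ⟨φ', hφ', hw'⟩ := hγ y
      generalize γ x = c at *
      generalize γ y = c' at *
      obtain ⟨j, w⟩ := c
      obtain ⟨j', w'⟩ := c'
      obtain ⟨rfl, h⟩ := Prod.mk.inj h
      refine ⟨j, φ, φ', hφ, hφ', fun a ↦ ?_⟩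
      rw [← hw, ← hw']
      exact mem_congrSubring_of_residue_eq (congrFun h a))
    (by
      rintro ⟨x, hx⟩ h
      refine ProjAtlas.exists_comp_eq_of_forall_congrIn (𝔄 := 𝔄) (W := W) i x hx fun k hk ↦ ?_
      obtain ⟨⟨_, hy⟩, ⟨y, rfl⟩, hxy⟩ := h k hk
      exact ⟨y, hy, hxy⟩)
    (M := (𝔄.n + 1) * Q ^ (𝔄.n + 1))
    (by
      rw [Nat.card_prod, Nat.card_eq_fintype_card, Fintype.card_fin, Nat.card_fun,
        Nat.card_eq_fintype_card (α := Fin (𝔄.n + 1)), Fintype.card_fin, pow_one]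
      exact Nat.mul_le_mul_left _ (Nat.pow_le_pow_left hcard _))
    hs x
  simp only [Set.mem_ofPred_eq, Points.iterate_map] at hmain
  exact hmain hx

end PreimagesQuestion

theorem mainTheorem4 (K : Type u) [Field K] [NumberField K]
    (X : Scheme.{u}) (p : X ⟶ Spec (CommRingCat.of K))
    (hX : PreimagesQuestion.IsProjectiveVariety p)
    (f : X ⟶ X) (hf : f ≫ p = p) [Etale f]
    (Y : Scheme.{u}) (i : Y ⟶ X) [IsClosedImmersion i]
    (hY : PreimagesQuestion.IsInvariant f i)
    (d : ℕ) (hd : 1 ≤ d) :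
    ∃ s₀ : ℕ, ∀ (L : Type u) [Field L] [Algebra K L] [FiniteDimensional K L],
      Module.finrank K L ≤ d → ∀ s : ℕ, s₀ ≤ s →
        IsEmpty (PreimagesQuestion.Points (PreimagesQuestion.preimageDiffι f i s ≫ p) L) :=
  PreimagesQuestion.exists_forall_isEmpty_points_preimageDiff K hX.isProjective f hf i hY d
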